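/- Let $\mathbb{F}_{\mathfrak p}$ be a finite field with algebraic closure $\bar{\mathbb F}_{\mathfrak p}$, and let $\sigma$ be the Frobenius automorphism of $\bar{\mathbb F}_{\mathfrak p}/\mathbb{F}_{\mathfrak p}$. Let $C'$ and $C$ be smooth projective geometrically integral curves over $\mathbb{F}_{\mathfrak p}$ and let $f\colon C'\to C$ be a finite unramified morphism defined over $\mathbb{F}_{\mathfrak p}$. Let $A=\operatorname{Aut}(C'_{\bar{\mathbb F}_{\mathfrak p}}/C_{\bar{\mathbb F}_{\mathfrak p}})$ be the group of automorphisms of $C'$ over $C$ defined over $\bar{\mathbb F}_{\mathfrak p}$. Assume that $A$ is abelian and that $f$ identifies $C_{\bar{\mathbb F}_{\mathfrak p}}$ with the quotient $C'_{\bar{\mathbb F}_{\mathfrak p}}/A$. The Galois group of $\bar{\mathbb F}_{\mathfrak p}/\mathbb{F}_{\mathfrak p}$ acts on $A$; write $A(\mathbb{F}_{\mathfrak p})$ for the subgroup of invariant elements. Then $A$ is finite. Let $$B=\{\sigma(a)\circ a^{-1} : a\in A\},$$ which is a subgroup of $A$. (a) The group $B$ is defined over $\mathbb{F}_{\mathfrak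 p}$ (that is, stable under $\operatorname{Gal}(\bar{\mathbb F}_{\mathfrak p}/\mathbb{F}_{\mathfrak p})$), and the curve $C_B=C'/B$ is defined over $\mathbb{F}_{\mathfrak p}$: there are a smooth projective geometrically integral curve $C_B$ over $\mathbb{F}_{\mathfrak p}$ and morphisms $C'\to C_B\to C$ over $\mathbb{F}_{\mathfrak p}$ with composite $f$ such that $C'\to C_B$ becomes, over $\bar{\mathbb F}_{\mathfrak p}$, the quotient of $C'$ by $B$. For every factorization $C'\to C_B\to C$ of $f$ over $\mathbb{F}_{\mathfrak p}$ such that $C'\to C_B$ becomes, over $\bar{\mathbb F}_{\mathfrak p}$, the quotient of $C'$ by $B$, the following hold. (b) The image of $C'(\mathbb{F}_{\mathfrak p})$ in $C(\mathbb{F}_{\mathfrak p})$ is the same as the image of $C_B(\mathbb{F}_{\mathfrak p})$ in $C(\mathbb{F}_{\mathfrak p})$. (c) If $R\in C(\mathbb{F}_{\mathfrak p})$ is in the image of $C'(\mathbb{F}_{\mathfrak p})$, then exactly $|A(\mathbb{F}_{\mathfrak p})|$ points of $C'(\mathbb{F}_{\mathfrak p})$ map to $R$. (d) If $R\in C(\mathbb{F}_{\mathfrak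 p})$ is in the image of $C_B(\mathbb{F}_{\mathfrak p})$, then exactly $(A:B)$ points of $C_B(\mathbb{F}_{\mathfrak p})$ map to $R$. -/

import Mathlib

open CategoryTheory CategoryTheory.Limits AlgebraicGeometry

universe u

/-- The category of schemes over a field `k`. -/
abbrev SchemeOver (k : Type u) [Field k] : Type (u + 1) :=
  Over (Spec (CommRingCat.of k))

/-- A smooth projective (geometrically irreducible) curve over a field `k`. For smooth curves over
a field, proper and projective are the same. -/
structure IsSmoothProjectiveCurve {k : Type u} [Field k] (X : SchemeOver k) : Prop where
  smooth : SmoothOfRelativeDimension 1 X.hom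
  proper : IsProper X.hom
  geometricallyIntegral : GeometricallyIntegral X.hom

/-- The set `X(k)` of `k`-rational points: sections of the structure morphism. -/
abbrev RationalPoint {k : Type u} [Field k] (X : SchemeOver k) : Type u :=
  Over.mk (𝟙 (Spec (CommRingCat.of k))) ⟶ X

section Quotient

/-- An open set pulled back from the quotient is stable under an automorphism of the cover. -/
theorem preimage_le_of_comp_eq {S : Scheme.{u}} {X Y : Over S} {π : X ⟶ Y} {a : X ⟶ X}
    (h : a ≫ π = π) (U : Y.left.Opens) :
    π.left ⁻¹ᵁ U ≤ a.left ⁻¹ᵁ (π.left ⁻¹ᵁ U) := by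
  rw [← Scheme.Hom.comp_preimage, ← Over.comp_left, h]

/-- `π : X ⟶ Y` is the quotient `Y = X / G` of the `S`-scheme `X` by a group `G` of
`S`-automorphisms: `Y` is the topological space of `G`-orbits with the quotient topology, and its
structure sheaf is the sheaf of `G`-invariant sections of the structure sheaf of `X`. -/
structure IsGeometricQuotient {S : Scheme.{u}} {X Y : Over S} (G : Subgroup (Aut X))
    (π : X ⟶ Y) : Prop where
  invariant : ∀ a ∈ G, a.hom ≫ π = π
  isQuotientMap : Topology.IsQuotientMap (fun x : X.left => π.left x)
  orbit : ∀ x y : X.left, π.left x = π.left y → ∃ a ∈ G, a.hom.left x = y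
  app_injective : ∀ U : Y.left.Opens, Function.Injective (π.left.app U)
  exists_app_eq : ∀ (U : Y.left.Opens) (s : Γ(X.left, π.left ⁻¹ᵁ U)),
    (∀ (a : Aut X) (ha : a ∈ G), a.hom.left.appLE (π.left ⁻¹ᵁ U) (π.left ⁻¹ᵁ U)
      (preimage_le_of_comp_eq (invariant a ha) U) s = s) →
    ∃ t : Γ(Y.left, U), π.left.app U t = s

end Quotient

noncomputable section

section BaseChange

variable {k : Type u} [Field k] (K : Type u) [Field K] [Algebra k K]

/-- The morphism `Spec K ⟶ Spec k` of a field extension `K / k`. -/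
abbrev specExt (k K : Type u) [Field k] [Field K] [Algebra k K] :
    Spec (CommRingCat.of K) ⟶ Spec (CommRingCat.of k) :=
  Spec.map (CommRingCat.ofHom (algebraMap k K))

/-- The base change `X_K = X ×ₖ K`. -/
abbrev extendScalars (X : SchemeOver k) : SchemeOver K :=
  Over.mk (pullback.snd X.hom (specExt k K))

/-- The base change `f_K : X_K ⟶ Y_K` of a morphism `f : X ⟶ Y` over `k`, on underlying
schemes. -/
def extendScalarsMapLeft {X Y : SchemeOver k} (f : X ⟶ Y) :
    (extendScalars K X).left ⟶ (extendScalars K Y).left :=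
  pullback.lift (f := Y.hom) (g := specExt k K)
    (pullback.fst X.hom (specExt k K) ≫ f.left) (pullback.snd X.hom (specExt k K))
    (by rw [Category.assoc, Over.w, pullback.condition])

theorem extendScalarsMapLeft_fst {X Y : SchemeOver k} (f : X ⟶ Y) :
    extendScalarsMapLeft K f ≫ pullback.fst Y.hom (specExt k K) =
      pullback.fst X.hom (specExt k K) ≫ f.left :=
  pullback.lift_fst _ _ _

theorem extendScalarsMapLeft_snd {X Y : SchemeOver k} (f : X ⟶ Y) :
    extendScalarsMapLeft K f ≫ pullback.snd Y.hom (specExt k K) =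
      pullback.snd X.hom (specExt k K) :=
  pullback.lift_snd _ _ _

/-- The base change `f_K : X_K ⟶ Y_K` of a morphism `f : X ⟶ Y` over `k`. -/
def extendScalarsMap {X Y : SchemeOver k} (f : X ⟶ Y) :
    extendScalars K X ⟶ extendScalars K Y :=
  Over.homMk (extendScalarsMapLeft K f) (extendScalarsMapLeft_snd K f)

variable {K}

/-- `Spec τ` for an element `τ` of `Gal(K/k)`. -/
abbrev specGal (τ : K ≃ₐ[k] K) : Spec (CommRingCat.of K) ⟶ Spec (CommRingCat.of K) :=
  Spec.map (CommRingCat.ofHom (τ : K →+* K))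

theorem specGal_comp_specExt (τ : K ≃ₐ[k] K) : specGal τ ≫ specExt k K = specExt k K := by
  rw [← Spec.map_comp, ← CommRingCat.ofHom_comp]
  congr 2
  ext x
  simp

theorem specGal_comp_inv (τ : K ≃ₐ[k] K) : specGal τ ≫ specGal τ⁻¹ = 𝟙 _ := by
  rw [← Spec.map_comp, ← CommRingCat.ofHom_comp, ← Spec.map_id, ← CommRingCat.ofHom_id]
  congr 2
  ext x
  exact τ.apply_symm_apply x

/-- The semilinear automorphism `id × Spec τ` of `X_K = X ×ₖ Spec K`. -/
def semilinear (X : SchemeOver k) (τ : K ≃ₐ[k] K) :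
    (extendScalars K X).left ⟶ (extendScalars K X).left :=
  pullback.lift (f := X.hom) (g := specExt k K)
    (pullback.fst X.hom (specExt k K)) (pullback.snd X.hom (specExt k K) ≫ specGal τ)
    (by rw [Category.assoc, specGal_comp_specExt, pullback.condition])

theorem semilinear_fst (X : SchemeOver k) (τ : K ≃ₐ[k] K) :
    semilinear X τ ≫ pullback.fst X.hom (specExt k K) = pullback.fst X.hom (specExt k K) :=
  pullback.lift_fst _ _ _

theorem semilinear_snd (X : SchemeOver k) (τ : K ≃ₐ[k] K) :
    semilinear X τ ≫ pullback.snd X.hom (specExt k K) =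
      pullback.snd X.hom (specExt k K) ≫ specGal τ :=
  pullback.lift_snd _ _ _

theorem semilinear_comp_inv (X : SchemeOver k) (τ : K ≃ₐ[k] K) :
    semilinear X τ ≫ semilinear X τ⁻¹ = 𝟙 _ := by
  apply pullback.hom_ext
  · rw [Category.assoc, semilinear_fst, semilinear_fst]
    exact (Category.id_comp _).symm
  · rw [Category.assoc, semilinear_snd, reassoc_of% semilinear_snd X τ, specGal_comp_inv,
      Category.comp_id]
    exact (Category.id_comp _).symm

theorem semilinear_inv_comp (X : SchemeOver k) (τ : K ≃ₐ[k] K) :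
    semilinear X τ⁻¹ ≫ semilinear X τ = 𝟙 _ := by
  simpa using semilinear_comp_inv X τ⁻¹

theorem semilinear_naturality {X Y : SchemeOver k} (f : X ⟶ Y) (τ : K ≃ₐ[k] K) :
    semilinear X τ ≫ (extendScalarsMap K f).left =
      (extendScalarsMap K f).left ≫ semilinear Y τ := by
  change semilinear X τ ≫ extendScalarsMapLeft K f = extendScalarsMapLeft K f ≫ semilinear Y τ
  apply pullback.hom_ext
  · rw [Category.assoc, Category.assoc, semilinear_fst, extendScalarsMapLeft_fst,
      reassoc_of% semilinear_fst X τ]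
  · rw [Category.assoc, Category.assoc, semilinear_snd, extendScalarsMapLeft_snd,
      reassoc_of% extendScalarsMapLeft_snd K f, semilinear_snd]

/-- The conjugate `τ(a)` of a `K`-endomorphism `a` of `X_K` by `τ ∈ Gal(K/k)`. On points it
satisfies `τ(a)(τ(P)) = τ(a(P))`. -/
def galConjHom {X : SchemeOver k} (τ : K ≃ₐ[k] K) (a : extendScalars K X ⟶ extendScalars K X) :
    extendScalars K X ⟶ extendScalars K X :=
  Over.homMk (semilinear X τ ≫ a.left ≫ semilinear X τ⁻¹) (by
    have h : a.left ≫ pullback.snd X.hom (specExt k K) = pullback.snd X.hom (specExt k K) :=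
      Over.w a
    have h' := specGal_comp_inv τ
    simp only [Over.mk_left, Over.mk_hom, Category.assoc]
    rw [semilinear_snd, reassoc_of% h, reassoc_of% semilinear_snd, h', Category.comp_id])

theorem galConjHom_comp {X : SchemeOver k} (τ : K ≃ₐ[k] K)
    (a b : extendScalars K X ⟶ extendScalars K X) :
    galConjHom τ (a ≫ b) = galConjHom τ a ≫ galConjHom τ b := by
  ext : 1
  simp [galConjHom, reassoc_of% semilinear_inv_comp X τ]

theorem galConjHom_id {X : SchemeOver k} (τ : K ≃ₐ[k] K) :
    galConjHom τ (𝟙 (extendScalars K X)) = 𝟙 _ := by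
  ext : 1
  simp [galConjHom, semilinear_comp_inv]

/-- The action of `τ ∈ Gal(K/k)` on the group `Aut(X_K)` of `K`-automorphisms. In Mathlib's group
`Aut`, the product `a * b` is the composite `a ∘ b`. -/
def galConj (X : SchemeOver k) (τ : K ≃ₐ[k] K) :
    Aut (extendScalars K X) →* Aut (extendScalars K X) where
  toFun a :=
    { hom := galConjHom τ a.hom
      inv := galConjHom τ a.inv
      hom_inv_id := by
        rw [← galConjHom_comp]
        exact (congrArg (galConjHom τ) (Iso.hom_inv_id a)).trans (galConjHom_id τ)
      inv_hom_id := by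
        rw [← galConjHom_comp]
        exact (congrArg (galConjHom τ) (Iso.inv_hom_id a)).trans (galConjHom_id τ) }
  map_one' := by
    ext1
    exact galConjHom_id τ
  map_mul' a b := by
    ext1
    exact galConjHom_comp τ b.hom a.hom

variable (K)

/-- The geometric automorphism group `A = Aut(X_K / Y_K)` of a morphism `f : X ⟶ Y` over `k`. -/
def deckGroup {X Y : SchemeOver k} (f : X ⟶ Y) : Subgroup (Aut (extendScalars K X)) where
  carrier := {a | a.hom ≫ extendScalarsMap K f = extendScalarsMap K f}
  mul_mem' {a b} ha hb := by
    change (b.hom ≫ a.hom) ≫ _ = _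
    rw [Category.assoc, ha, hb]
  one_mem' := Category.id_comp _
  inv_mem' {a} ha := by
    change a.inv ≫ _ = _
    exact (Iso.inv_comp_eq a).2 (Eq.symm ha)

variable {K}

theorem galConj_mem_deckGroup {X Y : SchemeOver k} (f : X ⟶ Y) (τ : K ≃ₐ[k] K)
    {a : Aut (extendScalars K X)} (ha : a ∈ deckGroup K f) :
    galConj X τ a ∈ deckGroup K f := by
  have ha' : a.hom.left ≫ (extendScalarsMap K f).left = (extendScalarsMap K f).left :=
    congrArg CommaMorphism.left ha
  change galConjHom τ a.hom ≫ extendScalarsMap K f = extendScalarsMap K f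
  ext : 1
  simp only [galConjHom, Over.comp_left, Over.homMk_left, Category.assoc]
  rw [semilinear_naturality, reassoc_of% ha', reassoc_of% semilinear_naturality, semilinear_comp_inv,
    Category.comp_id]

/-- The action of `τ ∈ Gal(K/k)` on `A = Aut(X_K / Y_K)`. -/
def deckGal {X Y : SchemeOver k} (f : X ⟶ Y) (τ : K ≃ₐ[k] K) :
    deckGroup K f →* deckGroup K f :=
  ((galConj X τ).comp (deckGroup K f).subtype).codRestrict (deckGroup K f)
    fun a => galConj_mem_deckGroup f τ a.2

variable (K)

/-- `A(k)`: the elements of `A = Aut(X_K / Y_K)` that are fixed by all of `Gal(K/k)`. -/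
def rationalDeck {X Y : SchemeOver k} (f : X ⟶ Y) : Set (deckGroup K f) :=
  {a | ∀ τ : K ≃ₐ[k] K, deckGal f τ a = a}

variable {K}

/-- A subgroup `B` of `A = Aut(X_K / Y_K)` is defined over `k` if it is stable under the action
of `Gal(K/k)`. -/
def IsDefinedOverBase {X Y : SchemeOver k} (f : X ⟶ Y) (B : Subgroup (deckGroup K f)) : Prop :=
  ∀ τ : K ≃ₐ[k] K, B.map (deckGal f τ) = B

/-- The morphisms `X ⟶ Z ⟶ Y` over `k` factor `f : X ⟶ Y`, and `X_K ⟶ Z_K` is the quotient of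
`X_K` by the subgroup `B` of `A = Aut(X_K / Y_K)`; that is, `Z` is a model over `k` of the
intermediate cover `X_K / B`. -/
structure IsQuotientModel {X Y Z : SchemeOver k} (f : X ⟶ Y) (B : Subgroup (deckGroup K f))
    (g : X ⟶ Z) (h : Z ⟶ Y) : Prop where
  fac : g ≫ h = f
  isGeometricQuotient :
    IsGeometricQuotient (B.map (deckGroup K f).subtype) (extendScalarsMap K g)

end BaseChange

/-- For an endomorphism `φ` of a commutative group `A`, the subgroup `{φ(a) a⁻¹ : a ∈ A}`. -/
def displacementSubgroup {A : Type*} [Group A] (hA : ∀ a b : A, a * b = b * a) (φ : A →* A) :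
    Subgroup A where
  carrier := {b | ∃ a : A, b = φ a * a⁻¹}
  mul_mem' := by
    rintro _ _ ⟨a, rfl⟩ ⟨b, rfl⟩
    refine ⟨a * b, ?_⟩
    rw [map_mul, mul_inv_rev, hA b⁻¹ a⁻¹, mul_assoc, mul_assoc, ← mul_assoc a⁻¹,
      ← mul_assoc (φ b), hA a⁻¹ (φ b)]
  one_mem' := ⟨1, by simp⟩
  inv_mem' := by
    rintro _ ⟨a, rfl⟩
    exact ⟨a⁻¹, by rw [mul_inv_rev, map_inv, hA]⟩

/-- A finite unramified morphism `f : C' ⟶ C` of smooth projective curves over `k` that is,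
over `K`, a Galois cover with abelian group `A = Aut(C'_K / C_K)`: the map `f_K` is the quotient of
`C'_K` by `A`. -/
structure IsUnramifiedAbelianCover {k : Type u} [Field k] (K : Type u) [Field K] [Algebra k K]
    {C' C : SchemeOver k} (f : C' ⟶ C) : Prop where
  isCurve_source : IsSmoothProjectiveCurve C'
  isCurve_target : IsSmoothProjectiveCurve C
  isFinite : IsFinite f.left
  unramified : FormallyUnramified f.left
  comm : ∀ a b : deckGroup K f, a * b = b * a
  isGeometricQuotient : IsGeometricQuotient (deckGroup K f) (extendScalarsMap K f)

/-- The subgroup `B = {σ(a) a⁻¹ : a ∈ A}` of `A = Aut(C'_K / C_K)`, with `σ` the Frobenius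
automorphism `x ↦ x ^ #k` of `K` over the finite field `k`. -/
def frobeniusSubgroup {k : Type u} [Field k] [Fintype k] (K : Type u) [Field K] [Algebra k K]
    [Algebra.IsAlgebraic k K] {C' C : SchemeOver k} (f : C' ⟶ C)
    (hA : ∀ a b : deckGroup K f, a * b = b * a) : Subgroup (deckGroup K f) :=
  displacementSubgroup hA (deckGal f (FiniteField.frobeniusAlgEquivOfAlgebraic k K))

end

/-!
Write `p : X_K ⟶ X` for the projection and `σ` for the Frobenius automorphism; an element of `K`
fixed by `σ` lies in `k`, so geometric points, and vectors of `V ⊗ₖ K`, that are fixed by `σ` are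
defined over `k`.

*Rigidity.* The diagonal of the unramified morphism `f_K` is an open and closed immersion and
`C'_K` is connected, so an element of `A` that fixes one point is trivial
(`IsUnramifiedAbelianCover.eq_one_of_comp_eq`). Hence `A` acts simply transitively on the geometric
fibres of `f`, and it is finite because these are.

*Points.* If `P` is a rational point of `C'`, then `σ(a(P)) = σ(a)(P)`, so `a(P)` is rational if
and only if `a` is fixed by the Galois group; this counts the fibre in `C'(k)`. The image of `a(P)`
in `C_B` is always rational, because `σ(a) ∈ B a`; this counts the fibre in `C_B(k)`. Lang's trick
lifts points: a rational point of `C_B` is the image of a geometric point `y` of `C'` with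
`σ(y) = b(y)` and `b = σ(c) c⁻¹`, and then `c⁻¹(y)` is a rational point of `C'` with the same image
in `C` (`IsUnramifiedAbelianCover.exists_comp_eq_of_isQuotientModel`).

*The curve `C_B`.* The subgroup `B` is Galois stable because the Galois group is commutative. The
scheme `C_B` is the coequalizer, in the category of schemes affine over `C`, of the pairs
`b ≫ p, p : C'_K ⟶ C'` with `b ∈ B`: over an affine open subset of `C`, its sections are the
functions on `C'` that are invariant under `B` over `K`
(`AffineCoequalizer.exists_factorization`). It is finite over `C`, which is noetherian. That its
base change to `K` is the quotient of `C'_K` by `B` is Galois descent: the invariant functions on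
`C'_K` form a `K`-space stable under the semilinear action of `σ`, so they are spanned by functions
on `C'` (`mem_span_of_semilinear_stable`, `isGeometricQuotient_extendScalarsMap`).

It remains to see that `C_B` is smooth. By rigidity `A` acts freely, so `C'_K` is flat over its
quotients by `A` and by `B` (`Module.Projective.of_isInvariant_of_free`,
`IsGeometricQuotient.flat`). Being unramified as well, `C' ⟶ C` and `C' ⟶ C_B` are étale over `K`,
hence over `k`, and then so is `C_B ⟶ C` (`etale_of_etale_comp`). Geometric integrality passes from
`C'` to its image `C_B`.
-/

open TensorProduct

/-! ### Galois descent for a single automorphism -/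

section GaloisDescent

variable {k K V VK : Type*} [Field k] [Field K] [Algebra k K] [AddCommGroup V] [Module k V]
  [AddCommGroup VK] [Module K VK] [Module k VK] [IsScalarTower k K VK]

/-- Galois descent of subspaces: let `σ` be an automorphism of `K` with fixed field `k`, and let
`VK = V ⊗ₖ K`. A `K`-subspace of `VK` that is stable under the `σ`-semilinear map `Φ = id ⊗ σ` is
spanned by vectors of `V`. -/
theorem mem_span_of_semilinear_stable {ι : V →ₗ[k] VK} (hι : IsBaseChange K ι) {σ : K →+* K}
    (hσ : ∀ c, σ c = c → c ∈ Set.range (algebraMap k K)) (Φ : VK →+ VK)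
    (hΦι : ∀ v, Φ (ι v) = ι v) (hΦ : ∀ (c : K) (x : VK), Φ (c • x) = σ c • Φ x)
    (W : Submodule K VK) (hW : ∀ x ∈ W, Φ x ∈ W) {x : VK} (hx : x ∈ W) :
    x ∈ Submodule.span K {y | y ∈ W ∧ y ∈ Set.range ι} := by
  classical
  let b := Module.Free.chooseBasis k V
  let B := hι.basis b
  have hB : ∀ i, B i = ι (b i) := fun i => hι.basis_apply b i
  have hrepr : ∀ (y : VK) i, B.repr (Φ y) i = σ (B.repr y i) := by
    intro y i
    conv_lhs => rw [← B.linearCombination_repr y, Finsupp.linearCombination_apply, Finsupp.sum,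
      map_sum]
    simp only [hΦ, hB, hΦι]
    simp only [← hB, map_sum, map_smul, Finsupp.coe_finsetSum, Finset.sum_apply,
      Finsupp.smul_apply, B.repr_self, smul_eq_mul]
    rw [Finset.sum_eq_single i]
    · simp
    · intro j _ hj
      simp [hj]
    · intro hi
      simp [Finsupp.notMem_support_iff.mp hi]
  -- A vector `z` of `W` of minimal support, normalised to have a coordinate `1`, is fixed by `Φ`,
  -- because the support of `Φ z - z` is smaller. Other vectors of `W` reduce to those of smaller
  -- support.
  have key : ∀ n : ℕ, ∀ y ∈ W, (B.repr y).support.card = n →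
      y ∈ Submodule.span K {y | y ∈ W ∧ y ∈ Set.range ι} := by
    intro n
    induction n using Nat.strong_induction_on with
    | _ n ih =>
    intro y hy hn
    by_cases hex : ∃ z ∈ W, z ≠ 0 ∧ (B.repr z).support ⊂ (B.repr y).support
    · obtain ⟨z, hz, hz0, hzy⟩ := hex
      obtain ⟨i, hi⟩ : ∃ i, B.repr z i ≠ 0 := by
        by_contra! h
        exact hz0 (B.repr.map_eq_zero_iff.mp (Finsupp.ext h))
      have hzs := ih _ (hn ▸ Finset.card_lt_card hzy) z hz rfl
      let c := B.repr y i / B.repr z i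
      have h1 : (B.repr (y - c • z)).support ⊂ (B.repr y).support := by
        refine Finset.ssubset_iff_of_subset ?_ |>.mpr ⟨i, hzy.1 (by simpa using hi), ?_⟩
        · intro j hj
          by_contra h
          have h' : B.repr z j = 0 := by
            by_contra h''
            exact h (hzy.1 (by simpa using h''))
          simp [h', Finsupp.notMem_support_iff.mp h] at hj
        · simp [c, hi]
      have h2 := ih _ (hn ▸ Finset.card_lt_card h1) _ (W.sub_mem hy (W.smul_mem c hz)) rfl
      simpa using Submodule.add_mem _ h2 (Submodule.smul_mem _ c hzs)
    · push Not at hex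
      by_cases hy0 : y = 0
      · simp [hy0]
      obtain ⟨i, hi⟩ : ∃ i, B.repr y i ≠ 0 := by
        by_contra! h
        exact hy0 (B.repr.map_eq_zero_iff.mp (Finsupp.ext h))
      let z := (B.repr y i)⁻¹ • y
      have hz : z ∈ W := W.smul_mem _ hy
      have hzi : B.repr z i = 1 := by simp [z, hi]
      have hfix : Φ z = z := by
        by_contra hne
        refine hex (Φ z - z) (W.sub_mem (hW _ hz) hz) (sub_ne_zero.mpr hne) ?_
        refine Finset.ssubset_iff_of_subset ?_ |>.mpr ⟨i, by simpa using hi, ?_⟩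
        · intro j hj
          by_contra h
          have h' : B.repr z j = 0 := by simp [z, Finsupp.notMem_support_iff.mp h]
          simp [h', hrepr] at hj
        · simp [hrepr, hzi]
      have hcoord : ∀ j, ∃ c : k, algebraMap k K c = B.repr z j := fun j =>
        hσ _ (by rw [← hrepr, hfix])
      choose d hd using hcoord
      have hzι : z ∈ Set.range ι := by
        refine ⟨∑ j ∈ (B.repr z).support, d j • b j, ?_⟩
        conv_rhs => rw [← B.linearCombination_repr z, Finsupp.linearCombination_apply, Finsupp.sum]
        simp [hB, ← hd]
      have : y = B.repr y i • z := by simp [z, smul_smul, hi]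
      rw [this]
      exact Submodule.smul_mem _ _ (Submodule.subset_span ⟨hz, hzι⟩)
  exact key _ x hx rfl

end GaloisDescent

/-! ### Free actions of finite groups on rings -/

section FreeAction

variable {G R S : Type*} [Group G] [Finite G] [CommRing R] [CommRing S] [Algebra R S]
  [MulSemiringAction G S] [SMulCommClass G R S]

/-- The Chase–Harrison–Rosenberg element `∑ xᵢ ⊗ yᵢ`, which satisfies `∑ xᵢ (g • yᵢ) = δ_{g, 1}`.
It is a product over `g ≠ 1`, because `x ⊗ y ↦ x (g • y)` is a ring homomorphism. -/
theorem exists_finset_sum_mul_smul_eq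
    (hfree : ∀ m : Ideal S, m.IsMaximal → ∀ g : G, g ≠ 1 → ∃ s : S, g • s - s ∉ m) :
    ∃ t : Finset (S × S), ∑ i ∈ t, i.1 * i.2 = 1 ∧ ∀ g : G, g ≠ 1 →
      ∑ i ∈ t, i.1 * g • i.2 = 0 := by
  classical
  have := Fintype.ofFinite G
  let μ (g : G) : S ⊗[ℤ] S →ₐ[ℤ] S :=
    Algebra.TensorProduct.lift (AlgHom.id ℤ S) (MulSemiringAction.toAlgHom ℤ S g)
      (fun _ _ => Commute.all _ _)
  have hμ : ∀ g x y, μ g (x ⊗ₜ y) = x * g • y := fun g x y => by simp [μ]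
  have h1 : ∀ g : G, g ≠ 1 → ∃ e : S ⊗[ℤ] S, μ g e = 0 ∧ μ 1 e = 1 := by
    intro g hg
    have hsurj : Function.Surjective (μ 1).toRingHom := fun s => ⟨s ⊗ₜ 1, by simp [hμ]⟩
    have htop : (RingHom.ker (μ g)).map (μ 1).toRingHom = ⊤ := by
      by_contra hne
      obtain ⟨m, hm, hle⟩ := Ideal.exists_le_maximal _ hne
      obtain ⟨s, hs⟩ := hfree m hm g hg
      refine hs (hle ?_)
      have : g • s - s = (μ 1).toRingHom ((g • s) ⊗ₜ 1 - 1 ⊗ₜ s) := by simp [hμ]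
      rw [this]
      refine Ideal.mem_map_of_mem _ ?_
      simp [RingHom.mem_ker, hμ]
    have h : (1 : S) ∈ (RingHom.ker (μ g)).map (μ 1).toRingHom := htop ▸ trivial
    obtain ⟨e, he, he'⟩ := (Ideal.mem_map_iff_of_surjective _ hsurj).mp h
    exact ⟨e, he, he'⟩
  choose! e he0 he1 using h1
  obtain ⟨t, ht⟩ := TensorProduct.exists_finset (∏ g ∈ Finset.univ.erase (1 : G), e g)
  refine ⟨t, ?_, fun g hg => ?_⟩
  · have := congrArg (μ 1) ht
    rw [map_prod, Finset.prod_eq_one (fun g hg => he1 g (Finset.ne_of_mem_erase hg))] at this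
    simpa [hμ] using this.symm
  · have := congrArg (μ g) ht
    rw [map_prod, Finset.prod_eq_zero (i := g) (by simp [hg]) (he0 g hg)] at this
    simpa [hμ] using this.symm

/-- A ring with a free action of a finite group is projective over the ring of invariants: if
`∑ xᵢ (g • yᵢ) = δ_{g, 1}`, then `s = ∑ xᵢ tr (yᵢ s)` for all `s`, where `tr` is the sum over the
group. -/
theorem Module.Projective.of_isInvariant_of_free [FaithfulSMul R S] [Algebra.IsInvariant R S G]
    (hfree : ∀ m : Ideal S, m.IsMaximal → ∀ g : G, g ≠ 1 → ∃ s : S, g • s - s ∉ m) :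
    Module.Projective R S := by
  classical
  have := Fintype.ofFinite G
  obtain ⟨t, ht1, ht0⟩ := exists_finset_sum_mul_smul_eq hfree
  have htr : ∀ s : S, ∃ r : R, algebraMap R S r = ∑ g : G, g • s := fun s =>
    Algebra.IsInvariant.isInvariant (G := G) _ fun h => by
      rw [Finset.smul_sum]
      exact Fintype.sum_equiv (Equiv.mulLeft h) _ _ fun g => by simp [mul_smul]
  choose tr htr using htr
  have hinj := FaithfulSMul.algebraMap_injective R S
  let trₗ : S →ₗ[R] R :=
    { toFun := tr
      map_add' x y := hinj (by simp [htr, Finset.sum_add_distrib])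
      map_smul' r x := hinj (by
        simp only [map_mul, htr, smul_eq_mul, RingHom.id_apply, smul_comm _ r, ← Finset.smul_sum]
        rw [Algebra.smul_def]) }
  let i : S →ₗ[R] (t → R) := LinearMap.pi fun j => trₗ ∘ₗ LinearMap.mulLeft R j.1.2
  let p : (t → R) →ₗ[R] S := ∑ j : t, (LinearMap.toSpanSingleton R S j.1.1) ∘ₗ LinearMap.proj j
  refine Module.Projective.of_split i p ?_
  ext s
  have h2 : ∀ j : S × S, tr (j.2 * s) • j.1 = ∑ g : G, (j.1 * g • j.2) * g • s := fun j => by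
    rw [Algebra.smul_def, htr, Finset.sum_mul]
    exact Finset.sum_congr rfl fun g _ => by rw [smul_mul']; ring
  have h3 : p (i s) = ∑ j ∈ t, tr (j.2 * s) • j.1 := by
    simp only [p, i, LinearMap.sum_apply, LinearMap.comp_apply, LinearMap.proj_apply,
      LinearMap.toSpanSingleton_apply, LinearMap.pi_apply, LinearMap.mulLeft_apply]
    exact Finset.sum_coe_sort t (fun j => tr (j.2 * s) • j.1)
  change p (i s) = s
  rw [h3, Finset.sum_congr rfl fun j _ => h2 j, Finset.sum_comm]
  simp only [← Finset.sum_mul]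
  rw [Finset.sum_eq_single 1]
  · simpa using congrArg (· * s) ht1
  · intro g _ hg
    rw [ht0 g hg, zero_mul]
  · simp

end FreeAction

/-! ### Étale algebras and faithfully flat étale covers of the source -/

section Etale

variable (R T S : Type*) [CommRing R] [CommRing T] [CommRing S] [Algebra R T] [Algebra R S]
  [Algebra T S] [IsScalarTower R T S]

/-- Flatness over `R` descends along a faithfully flat `T ⟶ S`, because `S ⊗[T] (T ⊗[R] N)` is
`S ⊗[R] N`. -/
theorem Module.Flat.of_faithfullyFlat_of_flat [Module.FaithfullyFlat T S] [Module.Flat R S] :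
    Module.Flat R T := by
  rw [Module.Flat.iff_lTensor_preserves_injective_linearMap]
  intro N P _ _ _ _ f hf
  let F : T ⊗[R] N →ₗ[T] T ⊗[R] P := f.baseChange T
  have hF : (LinearMap.lTensor T f : T ⊗[R] N → T ⊗[R] P) = F := rfl
  rw [hF, ← Module.FaithfullyFlat.lTensor_injective_iff_injective T S]
  have h : (LinearMap.lTensor S F : S ⊗[T] (T ⊗[R] N) → S ⊗[T] (T ⊗[R] P)) =
      (AlgebraTensorModule.cancelBaseChange R T T S P).symm ∘ LinearMap.lTensor S f ∘
        AlgebraTensorModule.cancelBaseChange R T T S N := by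
    have : (LinearMap.lTensor S F) =
        (AlgebraTensorModule.cancelBaseChange R T T S P).symm.toLinearMap ∘ₗ
          (AlgebraTensorModule.lTensor T S f) ∘ₗ
            (AlgebraTensorModule.cancelBaseChange R T T S N).toLinearMap := by
      ext s n
      simp [F]
    rw [this]
    rfl
  rw [h]
  exact (LinearEquiv.injective _).comp
    ((Module.Flat.lTensor_preserves_injective_linearMap f hf).comp (LinearEquiv.injective _))

/-- If `T ⟶ S` is étale and faithfully flat and `R ⟶ S` is étale, then `R ⟶ T` is étale: flatness
descends, and `S ⊗ Ω[T⁄R] = Ω[S⁄R] = 0`. -/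
theorem Algebra.Etale.of_faithfullyFlat_of_etale [Algebra.FinitePresentation R T]
    [Algebra.Etale T S] [Module.FaithfullyFlat T S] [Algebra.Etale R S] :
    Algebra.Etale R T := by
  have : Module.Flat R T := Module.Flat.of_faithfullyFlat_of_flat R T S
  have : Algebra.FormallyUnramified R T := by
    constructor
    have : Subsingleton (S ⊗[T] Ω[T⁄R]) :=
      (KaehlerDifferential.tensorKaehlerEquivOfFormallyEtale R T S).subsingleton
    exact Module.FaithfullyFlat.lTensor_reflects_triviality T S _
  exact Algebra.Etale.of_formallyUnramified_of_flat

end Etale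

/-! ### Affine coequalizers over a base scheme -/

section EqLocus

variable {I S S' E E' : Type*} [CommRing S] [CommRing S'] [CommRing E] [CommRing E']

/-- The subring on which two families of ring homomorphisms agree. -/
def familyEqLocus (u v : I → S →+* E) : Subring S :=
  ⨅ i, (u i).eqLocus (v i)

theorem mem_familyEqLocus {u v : I → S →+* E} {s : S} :
    s ∈ familyEqLocus u v ↔ ∀ i, u i s = v i s := by
  simp only [familyEqLocus, Subring.mem_iInf]
  rfl

/-- The formation of `familyEqLocus` commutes with localization, for finite families: after
multiplication by a power of `r`, a fraction on which the localized homomorphisms agree has a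
numerator on which the homomorphisms agree. -/
theorem isLocalization_away_familyEqLocus [Finite I] [Algebra S S'] [Algebra E E']
    {u v : I → S →+* E} {u' v' : I → S' →+* E'}
    (hu : ∀ i s, algebraMap E E' (u i s) = u' i (algebraMap S S' s))
    (hv : ∀ i s, algebraMap E E' (v i s) = v' i (algebraMap S S' s))
    (r : familyEqLocus u v) (e : E) (hur : ∀ i, u i r = e)
    [IsLocalization.Away (r : S) S'] [IsLocalization.Away e E']
    [Algebra (familyEqLocus u v) (familyEqLocus u' v')]
    (hT : ∀ t : familyEqLocus u v,
      (algebraMap (familyEqLocus u v) (familyEqLocus u' v') t : S') = algebraMap S S' t) :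
    IsLocalization.Away r (familyEqLocus u' v') := by
  have hvr : ∀ i, v i r = e := fun i => by rw [← mem_familyEqLocus.mp r.2 i, hur]
  have := Fintype.ofFinite I
  refine IsLocalization.Away.mk r ?_ ?_ ?_
  · obtain ⟨b, hb⟩ := (IsLocalization.Away.algebraMap_isUnit (S := S') (r : S)).exists_right_inv
    have hunit : ∀ i, IsUnit (u' i (algebraMap S S' r)) := fun i =>
      (IsLocalization.Away.algebraMap_isUnit (r : S)).map _
    have hbmem : b ∈ familyEqLocus u' v' := mem_familyEqLocus.mpr fun i => by
      have h1 : u' i (algebraMap S S' r) * u' i b = 1 := by rw [← map_mul, hb, map_one]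
      have h2 : v' i (algebraMap S S' r) * v' i b = 1 := by rw [← map_mul, hb, map_one]
      rw [← hv, hvr, ← hur i, hu] at h2
      exact (hunit i).mul_left_cancel (h1.trans h2.symm)
    refine IsUnit.of_mul_eq_one ⟨b, hbmem⟩ (Subtype.ext ?_)
    simpa [hT] using hb
  · intro s'
    obtain ⟨n, s, hs⟩ := IsLocalization.Away.surj (r : S) s'.1
    have hi : ∀ i, ∃ m, e ^ m * u i s = e ^ m * v i s := fun i => by
      refine IsLocalization.Away.exists_of_eq (S := E') e ?_
      rw [hu, hv, ← hs, map_mul, map_mul, mem_familyEqLocus.mp s'.2 i, map_pow, map_pow, ← hu,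
        ← hv, hur, hvr]
    choose m hm using hi
    let M := ∑ i, m i
    have hM : (r : S) ^ M * s ∈ familyEqLocus u v := mem_familyEqLocus.mpr fun i => by
      obtain ⟨l, hl⟩ := Nat.exists_eq_add_of_le
        (Finset.single_le_sum (f := m) (fun _ _ => Nat.zero_le _) (Finset.mem_univ i))
      rw [map_mul, map_mul, map_pow, map_pow, hur, hvr]
      change e ^ (∑ i, m i) * _ = e ^ (∑ i, m i) * _
      rw [hl, add_comm, pow_add, mul_assoc, mul_assoc, hm]
    refine ⟨M + n, ⟨_, hM⟩, Subtype.ext ?_⟩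
    rw [hT]
    simp only [Subring.coe_mul, SubmonoidClass.coe_pow, hT, map_mul, map_pow, ← hs, pow_add]
    ring
  · intro a b hab
    have h := congrArg Subtype.val hab
    rw [hT, hT] at h
    obtain ⟨n, hn⟩ := IsLocalization.Away.exists_of_eq (S := S') (r : S) h
    exact ⟨n, Subtype.ext hn⟩

end EqLocus

namespace AffineCoequalizer

variable {X Y Z : Scheme.{u}} (f : X ⟶ Y) {I : Type u} (a b : I → (Z ⟶ X)) (w : Z ⟶ Y)
  (ha : ∀ i, a i ≫ f = w) (hb : ∀ i, b i ≫ f = w)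

theorem preimage_le_preimage {f : X ⟶ Y} {c : Z ⟶ X} {w : Z ⟶ Y} (h : c ≫ f = w) (U : Y.Opens) :
    w ⁻¹ᵁ U ≤ c ⁻¹ᵁ (f ⁻¹ᵁ U) := by
  rw [← Scheme.Hom.comp_preimage, h]

/-- The sections of `X` over the preimage of `U` on which all `aᵢ` and `bᵢ` agree. -/
abbrev sections (U : Y.Opens) : Subring Γ(X, f ⁻¹ᵁ U) :=
  familyEqLocus
    (fun i => ((a i).appLE (f ⁻¹ᵁ U) (w ⁻¹ᵁ U) (preimage_le_preimage (ha i) U)).hom)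
    (fun i => ((b i).appLE (f ⁻¹ᵁ U) (w ⁻¹ᵁ U) (preimage_le_preimage (hb i) U)).hom)

theorem restrict_mem_sections {U V : Y.Opens} (hUV : U ≤ V) {s : Γ(X, f ⁻¹ᵁ V)}
    (hs : s ∈ sections f a b w ha hb V) :
    X.presheaf.map (homOfLE (f.preimage_mono hUV)).op s ∈ sections f a b w ha hb U := by
  refine mem_familyEqLocus.mpr fun i => ?_
  have h := congrArg (Z.presheaf.map (homOfLE (w.preimage_mono hUV)).op)
    (mem_familyEqLocus.mp hs i)
  simp only [← CommRingCat.comp_apply, Scheme.Hom.appLE_map, Scheme.Hom.map_appLE] at h ⊢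
  exact h

/-- The restriction of sections on which all `aᵢ` and `bᵢ` agree. -/
def sectionsRes {U V : Y.Opens} (hUV : U ≤ V) :
    CommRingCat.of (sections f a b w ha hb V) ⟶ .of (sections f a b w ha hb U) :=
  CommRingCat.ofHom ((X.presheaf.map (homOfLE (f.preimage_mono hUV)).op).hom.restrict _ _
    fun _ hs => restrict_mem_sections f a b w ha hb hUV hs)

/-- The presheaf of sections on which all `aᵢ` and `bᵢ` agree. -/
def diagram : Y.Opensᵒᵖ ⥤ CommRingCat.{u} where
  obj U := .of (sections f a b w ha hb U.unop)
  map {V U} i := sectionsRes f a b w ha hb i.unop.le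
  map_id U := by
    ext s
    change X.presheaf.map (𝟙 _) s.1 = s.1
    simp
  map_comp {U V W} i j := by
    ext s
    change X.presheaf.map _ s.1 = X.presheaf.map _ (X.presheaf.map _ s.1)
    rw [← CommRingCat.comp_apply, ← Functor.map_comp]
    rfl

/-- The sections of `Y`, as sections of `X` on which all `aᵢ` and `bᵢ` agree. -/
def toSections (U : Y.Opens) : Γ(Y, U) ⟶ .of (sections f a b w ha hb U) :=
  CommRingCat.ofHom ((f.app U).hom.codRestrict _ fun r => mem_familyEqLocus.mpr fun i => by
    simp only [← CommRingCat.comp_apply, Scheme.Hom.app_eq_appLE, Scheme.Hom.appLE_comp_appLE,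
      ha, hb])

/-- The structure map of the presheaf of algebras `diagram`. -/
def diagramMap : Y.presheaf ⟶ diagram f a b w ha hb where
  app U := toSections f a b w ha hb U.unop
  naturality {U V} i := by
    ext s
    exact Subtype.ext congr($(f.naturality i) s)

open Scheme.AffineZariskiSite in
/-- The presheaf `diagram` is quasi-coherent: on affine open sets it is compatible with
localization. -/
theorem coequifibered_diagramMap [Finite I] [QuasiCompact f] [QuasiSeparated f] [QuasiCompact w]
    [QuasiSeparated w] :
    ((toOpensFunctor Y).op.whiskerLeft (diagramMap f a b w ha hb)).Coequifibered := by
  refine coequifibered_iff_forall_isLocalizationAway.mpr fun U r => ?_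
  have key : ∀ {W : Scheme.{u}} (h : W ⟶ Y) [QuasiCompact h] [QuasiSeparated h],
      letI := (W.presheaf.map (homOfLE (h.preimage_mono (Y.basicOpen_le r))).op).hom.toAlgebra
      IsLocalization.Away (h.app U.1 r) Γ(W, h ⁻¹ᵁ Y.basicOpen r) := by
    intro W h _ _
    let inst : Algebra Γ(W, h ⁻¹ᵁ U.1) Γ(W, h ⁻¹ᵁ Y.basicOpen r) :=
      (W.presheaf.map (homOfLE (h.preimage_mono (Y.basicOpen_le r))).op).hom.toAlgebra
    change IsLocalization.Away (h.app U.1 r) Γ(W, h ⁻¹ᵁ Y.basicOpen r)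
    let : Algebra Γ(W, h ⁻¹ᵁ U.1) Γ(W, W.basicOpen (h.app _ r)) :=
      (W.presheaf.map (homOfLE (W.basicOpen_le _)).op).hom.toAlgebra
    dsimp +instances [inst]
    rw! (castMode := .all) [h.preimage_basicOpen r]
    exact isLocalization_basicOpen_of_qcqs (h.isCompact_preimage U.2.isCompact)
      (h.isQuasiSeparated_preimage U.2.isQuasiSeparated) (h.app _ r)
  let inst1 : Algebra Γ(X, f ⁻¹ᵁ U.1) Γ(X, f ⁻¹ᵁ Y.basicOpen r) :=
    (X.presheaf.map (homOfLE (f.preimage_mono (Y.basicOpen_le r))).op).hom.toAlgebra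
  let inst2 : Algebra Γ(Z, w ⁻¹ᵁ U.1) Γ(Z, w ⁻¹ᵁ Y.basicOpen r) :=
    (Z.presheaf.map (homOfLE (w.preimage_mono (Y.basicOpen_le r))).op).hom.toAlgebra
  let inst3 : Algebra (sections f a b w ha hb U.1) (sections f a b w ha hb (Y.basicOpen r)) :=
    ((diagram f a b w ha hb).map (homOfLE (Y.basicOpen_le r)).op).hom.toAlgebra
  have : IsLocalization.Away (f.app U.1 r) Γ(X, f ⁻¹ᵁ Y.basicOpen r) := key f
  have : IsLocalization.Away (w.app U.1 r) Γ(Z, w ⁻¹ᵁ Y.basicOpen r) := key w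
  have hr : f.app U.1 r ∈ sections f a b w ha hb U.1 :=
    ((diagramMap f a b w ha hb).app (.op U.1) r).2
  change IsLocalization.Away (⟨f.app U.1 r, hr⟩ : sections f a b w ha hb U.1)
    (sections f a b w ha hb (Y.basicOpen r))
  refine isLocalization_away_familyEqLocus (e := w.app U.1 r) ?_ ?_ _ ?_ ?_
  · intro i s
    simp only [RingHom.algebraMap_toAlgebra, inst1, inst2]
    simp only [← CommRingCat.comp_apply, Scheme.Hom.appLE_map, Scheme.Hom.map_appLE]
  · intro i s
    simp only [RingHom.algebraMap_toAlgebra, inst1, inst2]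
    simp only [← CommRingCat.comp_apply, Scheme.Hom.appLE_map, Scheme.Hom.map_appLE]
  · intro i
    change (a i).appLE _ _ _ (f.app U.1 r) = _
    simp only [← CommRingCat.comp_apply, Scheme.Hom.app_eq_appLE, Scheme.Hom.appLE_comp_appLE, ha]
  · intro t
    rfl

end AffineCoequalizer

namespace AffineCoequalizer

noncomputable section

open Scheme.AffineZariskiSite

/-- The transition maps of the cover of `X` by the preimages of the affine open sets of `Y` are the
inclusions of open sets. -/
theorem trans_pullbackRestrictIsoRestrict_hom {X Y : Scheme.{u}} (f : X ⟶ Y)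
    {U V : Y.AffineZariskiSite} (i : U ⟶ V) (hUV : U.1 ≤ V.1) :
    (show pullback f U.1.ι ⟶ pullback f V.1.ι from
      Scheme.Cover.trans ((directedCover Y).pullback₁ f) i) ≫
        (pullbackRestrictIsoRestrict f V.1).hom =
      (pullbackRestrictIsoRestrict f U.1).hom ≫ X.homOfLE (f.preimage_mono hUV) := by
  rw [← cancel_mono (f ⁻¹ᵁ V.1).ι, Category.assoc, Category.assoc, Scheme.homOfLE_ι,
    pullbackRestrictIsoRestrict_hom_ι, pullbackRestrictIsoRestrict_hom_ι]
  exact (pullback.lift_fst _ _ _).trans (Category.comp_id _)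

variable {X Y Z : Scheme.{u}} (f : X ⟶ Y) {I : Type u} (a b : I → (Z ⟶ X)) (w : Z ⟶ Y)
  (ha : ∀ i, a i ≫ f = w) (hb : ∀ i, b i ≫ f = w)
  [Finite I] [IsAffineHom f] [QuasiCompact w] [QuasiSeparated w]

/-- The diagram of affine schemes that glue to the affine coequalizer. -/
def glueData : (directedCover Y).RelativeGluingData :=
  relativeGluingData (coequifibered_diagramMap f a b w ha hb)

instance : ((glueData f a b w ha hb).functor ⋙ Scheme.forget).IsLocallyDirected :=
  Scheme.Cover.RelativeGluingData.instIsLocallyDirectedI₀CompFunctorForgetOfIsThin ..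

/-- The coequalizer, in schemes affine over `Y`, of the pairs of morphisms `aᵢ, bᵢ : Z ⟶ X`. -/
def obj : Scheme.{u} := (glueData f a b w ha hb).glued

/-- The structure morphism of the affine coequalizer. -/
def toBase : obj f a b w ha hb ⟶ Y := (glueData f a b w ha hb).toBase

variable {U V : Y.Opens} (hU : IsAffineOpen U) (hV : IsAffineOpen V)

/-- The chart `Spec T ⟶ Q` over the affine open set `U`, where `T` is the ring of sections of `X`
over `U` on which all `aᵢ` and `bᵢ` agree. -/
def chart : Spec (.of (sections f a b w ha hb U)) ⟶ obj f a b w ha hb :=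
  colimit.ι (glueData f a b w ha hb).functor (⟨U, hU⟩ : Y.AffineZariskiSite)

instance isOpenImmersion_chart : IsOpenImmersion (chart f a b w ha hb hU) :=
  have (U : Y.AffineZariskiSite) :
      IsOpenImmersion (colimit.ι (glueData f a b w ha hb).functor U) := inferInstance
  this ⟨U, hU⟩

theorem chart_toBase :
    chart f a b w ha hb hU ≫ toBase f a b w ha hb =
      Spec.map (toSections f a b w ha hb U) ≫ hU.fromSpec :=
  colimit.ι_desc _ _

theorem map_chart {U V : Y.AffineZariskiSite} (i : U ⟶ V) (hUV : U.1 ≤ V.1) :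
    Spec.map (sectionsRes f a b w ha hb hUV) ≫ chart f a b w ha hb V.2 =
      chart f a b w ha hb U.2 :=
  colimit.w (glueData f a b w ha hb).functor i

theorem toBase_preimage :
    toBase f a b w ha hb ⁻¹ᵁ U = (chart f a b w ha hb hU).opensRange := by
  refine Eq.trans ?_ ((glueData f a b w ha hb).toBase_preimage_eq_opensRange_ι
    (⟨U, hU⟩ : Y.AffineZariskiSite))
  change toBase f a b w ha hb ⁻¹ᵁ U = toBase f a b w ha hb ⁻¹ᵁ U.ι.opensRange
  rw [Scheme.Opens.opensRange_ι]

/-- The inclusion of the ring of sections on which all `aᵢ` and `bᵢ` agree. -/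
def incl (U : Y.Opens) : CommRingCat.of (sections f a b w ha hb U) ⟶ Γ(X, f ⁻¹ᵁ U) :=
  CommRingCat.ofHom (sections f a b w ha hb U).subtype

/-- The morphism from `X` to the affine coequalizer over the affine open set `U`. -/
def fromChart : (f ⁻¹ᵁ U).toScheme ⟶ obj f a b w ha hb :=
  (f ⁻¹ᵁ U).toSpecΓ ≫ Spec.map (incl f a b w ha hb U) ≫ chart f a b w ha hb hU

theorem homOfLE_fromChart {U V : Y.AffineZariskiSite} (i : U ⟶ V) (hUV : U.1 ≤ V.1) :
    X.homOfLE (f.preimage_mono hUV) ≫ fromChart f a b w ha hb V.2 =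
      fromChart f a b w ha hb U.2 := by
  have h : incl f a b w ha hb V.1 ≫ X.presheaf.map (homOfLE (f.preimage_mono hUV)).op =
      sectionsRes f a b w ha hb hUV ≫ incl f a b w ha hb U.1 := rfl
  rw [fromChart, ← Scheme.Opens.toSpecΓ_SpecMap_presheaf_map_assoc, ← Spec.map_comp_assoc, h,
    Spec.map_comp_assoc, map_chart f a b w ha hb i hUV, fromChart]

theorem trans_comp_fromChart {U V : Y.AffineZariskiSite} (i : U ⟶ V) :
    (show pullback f U.1.ι ⟶ pullback f V.1.ι from
      Scheme.Cover.trans ((directedCover Y).pullback₁ f) i) ≫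
        (pullbackRestrictIsoRestrict f V.1).hom ≫ fromChart f a b w ha hb V.2 =
      (pullbackRestrictIsoRestrict f U.1).hom ≫ fromChart f a b w ha hb U.2 := by
  have hUV : U.1 ≤ V.1 := toOpens_mono (leOfHom i)
  rw [← homOfLE_fromChart f a b w ha hb i hUV, ← Category.assoc, ← Category.assoc,
    trans_pullbackRestrictIsoRestrict_hom f i hUV]

/-- The morphism from `X` to the affine coequalizer. -/
def π : X ⟶ obj f a b w ha hb :=
  Scheme.OpenCover.glueMorphismsOfLocallyDirected ((directedCover Y).pullback₁ f)
    (fun U => (pullbackRestrictIsoRestrict f U.1).hom ≫ fromChart f a b w ha hb U.2)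
    fun {_ _} i => trans_comp_fromChart f a b w ha hb i

theorem ι_π : (f ⁻¹ᵁ U).ι ≫ π f a b w ha hb = fromChart f a b w ha hb hU := by
  rw [← cancel_epi (pullbackRestrictIsoRestrict f U).hom, ← Category.assoc]
  trans ((directedCover Y).pullback₁ f).f (⟨U, hU⟩ : Y.AffineZariskiSite) ≫ π f a b w ha hb
  · congr 1
    exact pullbackRestrictIsoRestrict_hom_ι f U
  delta π
  exact Scheme.OpenCover.map_glueMorphismsOfLocallyDirected ..

theorem fromSpec_π :
    (hU.preimage f).fromSpec ≫ π f a b w ha hb =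
      Spec.map (incl f a b w ha hb U) ≫ chart f a b w ha hb hU := by
  rw [← cancel_epi (hU.preimage f).isoSpec.hom, IsAffineOpen.isoSpec_hom_fromSpec_assoc,
    ι_π f a b w ha hb hU, IsAffineOpen.isoSpec_hom, fromChart]

theorem π_toBase : π f a b w ha hb ≫ toBase f a b w ha hb = f := by
  refine Scheme.Cover.hom_ext (X.openCoverOfIsOpenCover _
    (.comap (iSup_affineOpens_eq_top Y) f.base.hom)) _ _ fun U ↦ ?_
  have hchart {U : Y.Opens} (hU : IsAffineOpen U) :
      (f ⁻¹ᵁ U).ι ≫ π f a b w ha hb ≫ toBase f a b w ha hb = (f ⁻¹ᵁ U).ι ≫ f := by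
    have h : toSections f a b w ha hb U ≫ incl f a b w ha hb U = f.app U := rfl
    rw [← Category.assoc, ι_π f a b w ha hb hU, fromChart, Category.assoc, Category.assoc,
      chart_toBase, ← Spec.map_comp_assoc, h]
    simp
  exact hchart U.2

/-- The affine coequalizer is affine over the base. -/
instance : IsAffineHom (toBase f a b w ha hb) := by
  refine isAffineHom_of_forall_exists_isAffineOpen _ fun y => ?_
  obtain ⟨_, ⟨U, hU, rfl⟩, hyU, -⟩ :=
    Y.isBasis_affineOpens.exists_subset_of_mem_open (Set.mem_univ y) isOpen_univ
  have := isOpenImmersion_chart f a b w ha hb hU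
  exact ⟨U, hyU, hU, toBase_preimage f a b w ha hb hU ▸
    isAffineOpen_opensRange (chart f a b w ha hb hU)⟩

theorem π_appLE_eq :
    (π f a b w ha hb).appLE (toBase f a b w ha hb ⁻¹ᵁ U) (f ⁻¹ᵁ U)
      (preimage_le_preimage (π_toBase f a b w ha hb) U) =
    (chart f a b w ha hb hU).appLE (toBase f a b w ha hb ⁻¹ᵁ U) ⊤
      (by rw [toBase_preimage f a b w ha hb hU]; simp) ≫
      (Scheme.ΓSpecIso _).hom ≫ incl f a b w ha hb U := by
  have h1 : (hU.preimage f).fromSpec.appLE (f ⁻¹ᵁ U) ⊤ (by simp) = (Scheme.ΓSpecIso _).inv := by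
    simp [Scheme.Hom.appLE, IsAffineOpen.fromSpec_app_self, ← Functor.map_comp]
  have h2 : (Spec.map (incl f a b w ha hb U)).appLE ⊤ ⊤ le_top =
      (Spec.map (incl f a b w ha hb U)).appTop := by
    simp [Scheme.Hom.app_eq_appLE]
  have h3 : ∀ {c d : Spec Γ(X, f ⁻¹ᵁ U) ⟶ obj f a b w ha hb} (_ : c = d) (V hc hd),
      c.appLE V ⊤ hc = d.appLE V ⊤ hd := by
    rintro c _ rfl V _ _
    rfl
  rw [← cancel_mono (Scheme.ΓSpecIso _).inv, Category.assoc, Category.assoc,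
    Scheme.ΓSpecIso_inv_naturality (incl f a b w ha hb U), Iso.hom_inv_id_assoc, ← h2, ← h1,
    Scheme.Hom.appLE_comp_appLE]
  exact (h3 (fromSpec_π f a b w ha hb hU) _ _ (by simp [toBase_preimage f a b w ha hb hU])).trans
    (Scheme.Hom.appLE_comp_appLE _ _ _ _ _ _ _).symm

theorem isIso_chart_appLE :
    IsIso ((chart f a b w ha hb hU).appLE (toBase f a b w ha hb ⁻¹ᵁ U) ⊤
      (by rw [toBase_preimage f a b w ha hb hU]; simp)) := by
  have := Scheme.Hom.isIso_app (chart f a b w ha hb hU) (toBase f a b w ha hb ⁻¹ᵁ U)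
    (toBase_preimage f a b w ha hb hU).le
  have h : (⊤ : (Spec (.of (sections f a b w ha hb U))).Opens) =
      chart f a b w ha hb hU ⁻¹ᵁ (toBase f a b w ha hb ⁻¹ᵁ U) := by
    rw [toBase_preimage f a b w ha hb hU]; simp
  have h' : (homOfLE h.le).op = (eqToHom h).op := rfl
  rw [Scheme.Hom.appLE, h']
  infer_instance

include hU in
/-- Over an affine open set, the sections of the affine coequalizer are those sections of `X` on
which all `aᵢ` and `bᵢ` agree. -/
theorem exists_π_appLE_eq {s : Γ(X, f ⁻¹ᵁ U)} (hs : s ∈ sections f a b w ha hb U) :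
    ∃ t, (π f a b w ha hb).appLE (toBase f a b w ha hb ⁻¹ᵁ U) (f ⁻¹ᵁ U)
      (preimage_le_preimage (π_toBase f a b w ha hb) U) t = s := by
  have := isIso_chart_appLE f a b w ha hb hU
  obtain ⟨t, ht⟩ := (ConcreteCategory.bijective_of_isIso
    ((chart f a b w ha hb hU).appLE (toBase f a b w ha hb ⁻¹ᵁ U) ⊤
      (by rw [toBase_preimage f a b w ha hb hU]; simp) ≫
      (Scheme.ΓSpecIso _).hom)).2 ⟨s, hs⟩
  refine ⟨t, ?_⟩
  rw [π_appLE_eq f a b w ha hb hU, ← Category.assoc, CommRingCat.comp_apply, ht]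
  rfl

include hU in
theorem π_appLE_injective :
    Function.Injective ((π f a b w ha hb).appLE (toBase f a b w ha hb ⁻¹ᵁ U) (f ⁻¹ᵁ U)
      (preimage_le_preimage (π_toBase f a b w ha hb) U)) := by
  have := isIso_chart_appLE f a b w ha hb hU
  have hinj := (ConcreteCategory.bijective_of_isIso
    ((chart f a b w ha hb hU).appLE (toBase f a b w ha hb ⁻¹ᵁ U) ⊤
      (by rw [toBase_preimage f a b w ha hb hU]; simp) ≫
      (Scheme.ΓSpecIso _).hom)).1
  rw [π_appLE_eq f a b w ha hb hU, ← Category.assoc]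
  exact Subtype.val_injective.comp hinj

theorem comp_π_eq (i : I) : a i ≫ π f a b w ha hb = b i ≫ π f a b w ha hb := by
  refine Scheme.Cover.hom_ext (Z.openCoverOfIsOpenCover _
    (.comap (iSup_affineOpens_eq_top Y) w.base.hom)) _ _ fun U ↦ ?_
  have key {U : Y.Opens} (hU : IsAffineOpen U) {c : Z ⟶ X} (hc : c ≫ f = w) :
      (w ⁻¹ᵁ U).ι ≫ c ≫ π f a b w ha hb = (w ⁻¹ᵁ U).toSpecΓ ≫
        Spec.map (incl f a b w ha hb U ≫ c.appLE (f ⁻¹ᵁ U) (w ⁻¹ᵁ U)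
          (preimage_le_preimage hc U)) ≫ chart f a b w ha hb hU := by
    rw [Spec.map_comp_assoc, ← fromSpec_π f a b w ha hb hU]
    simp
  refine (key U.2 (ha i)).trans (Eq.trans ?_ (key U.2 (hb i)).symm)
  congr 3
  ext s
  exact mem_familyEqLocus.mp s.2 i

end

end AffineCoequalizer

/-! ### Sheaves of invariants -/

namespace AffineCoequalizer

section

variable {X Y Z : Scheme.{u}} (f : X ⟶ Y) {I : Type u} (a b : I → (Z ⟶ X)) (w : Z ⟶ Y)
  (ha : ∀ i, a i ≫ f = w) (hb : ∀ i, b i ≫ f = w)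

theorem isLocalization_away_sections [Finite I] [QuasiCompact f] [QuasiSeparated f]
    [QuasiCompact w] [QuasiSeparated w] {V : Y.Opens} (hV : IsAffineOpen V) (r : Γ(Y, V)) :
    letI : Algebra (sections f a b w ha hb V) (sections f a b w ha hb (Y.basicOpen r)) :=
      (sectionsRes f a b w ha hb (Y.basicOpen_le r)).hom.toAlgebra
    IsLocalization.Away
      (show sections f a b w ha hb V from toSections f a b w ha hb V r)
      (sections f a b w ha hb (Y.basicOpen r)) :=
  Scheme.AffineZariskiSite.coequifibered_iff_forall_isLocalizationAway.mp
    (coequifibered_diagramMap f a b w ha hb) (⟨V, hV⟩ : Y.AffineZariskiSite) r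

theorem exists_app_eq_basicOpen [Finite I] [QuasiCompact f] [QuasiSeparated f]
    [QuasiCompact w] [QuasiSeparated w] {V : Y.Opens} (hV : IsAffineOpen V)
    (h : ∀ s ∈ sections f a b w ha hb V, ∃ t, f.app V t = s) (r : Γ(Y, V))
    {s : Γ(X, f ⁻¹ᵁ Y.basicOpen r)} (hs : s ∈ sections f a b w ha hb (Y.basicOpen r)) :
    ∃ t, f.app (Y.basicOpen r) t = s := by
  let inst : Algebra (sections f a b w ha hb V) (sections f a b w ha hb (Y.basicOpen r)) :=
    (sectionsRes f a b w ha hb (Y.basicOpen_le r)).hom.toAlgebra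
  let r' : sections f a b w ha hb V := toSections f a b w ha hb V r
  have : IsLocalization.Away r' (sections f a b w ha hb (Y.basicOpen r)) :=
    isLocalization_away_sections f a b w ha hb hV r
  have hnat (t : Γ(Y, V)) : f.app _ (Y.presheaf.map (homOfLE (Y.basicOpen_le r)).op t) =
      X.presheaf.map (homOfLE (f.preimage_mono (Y.basicOpen_le r))).op (f.app V t) :=
    congr($(f.naturality (homOfLE (Y.basicOpen_le r)).op) t)
  obtain ⟨n, x, hx⟩ := IsLocalization.Away.surj r'
    (⟨s, hs⟩ : sections f a b w ha hb (Y.basicOpen r))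
  obtain ⟨y, hy⟩ := h x.1 x.2
  obtain ⟨c, hc⟩ : ∃ c, Y.presheaf.map (homOfLE (Y.basicOpen_le r)).op r * c = 1 :=
    (RingedSpace.isUnit_res_basicOpen Y.toRingedSpace r).exists_right_inv
  refine ⟨Y.presheaf.map (homOfLE (Y.basicOpen_le r)).op y * c ^ n, ?_⟩
  have hx' : s * f.app _ (Y.presheaf.map (homOfLE (Y.basicOpen_le r)).op r) ^ n =
      f.app _ (Y.presheaf.map (homOfLE (Y.basicOpen_le r)).op y) := by
    rw [hnat, hnat, hy]
    exact congrArg Subtype.val hx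
  rw [map_mul, ← hx', map_pow, mul_assoc, ← mul_pow, ← map_mul]
  erw [hc]
  simp

/-- If every point of `Y` has an affine neighbourhood over which the sections of `X` on which all
`aᵢ` and `bᵢ` agree come from `Y`, then this holds over every open subset of `Y`. -/
theorem exists_app_eq_of_cover [Finite I] [QuasiCompact f] [QuasiSeparated f]
    [QuasiCompact w] [QuasiSeparated w] (hinj : ∀ U, Function.Injective (f.app U))
    (h : ∀ y : Y, ∃ V : Y.Opens, IsAffineOpen V ∧ y ∈ V ∧
      ∀ s ∈ sections f a b w ha hb V, ∃ t, f.app V t = s)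
    (U : Y.Opens) {s : Γ(X, f ⁻¹ᵁ U)} (hs : s ∈ sections f a b w ha hb U) :
    ∃ t, f.app U t = s := by
  have hloc : ∀ y : U, ∃ (W : Y.Opens) (hW : W ≤ U) (t : Γ(Y, W)), y.1 ∈ W ∧
      f.app W t = X.presheaf.map (homOfLE (f.preimage_mono hW)).op s := by
    rintro ⟨y, hyU⟩
    obtain ⟨V, hV, hyV, hVs⟩ := h y
    obtain ⟨r, hrU, hyr⟩ := hV.exists_basicOpen_le ⟨y, hyU⟩ hyV
    obtain ⟨t, ht⟩ := exists_app_eq_basicOpen f a b w ha hb hV hVs r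
      (restrict_mem_sections f a b w ha hb hrU hs)
    exact ⟨_, hrU, t, hyr, ht⟩
  choose W hW t hyW ht using hloc
  have hnat {V V' : Y.Opens} (hV : V' ≤ V) (t : Γ(Y, V)) :
      f.app _ (Y.presheaf.map (homOfLE hV).op t) =
        X.presheaf.map (homOfLE (f.preimage_mono hV)).op (f.app V t) :=
    congr($(f.naturality (homOfLE hV).op) t)
  obtain ⟨g, hg, -⟩ := Y.sheaf.existsUnique_gluing' W U (fun y => homOfLE (hW y))
    (fun y hy => TopologicalSpace.Opens.mem_iSup.mpr ⟨⟨y, hy⟩, hyW _⟩) t (by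
      intro y z
      apply hinj
      refine (hnat inf_le_left (t y)).trans (Eq.trans ?_ (hnat inf_le_right (t z)).symm)
      rw [ht, ht, ← CommRingCat.comp_apply, ← CommRingCat.comp_apply, ← Functor.map_comp,
        ← Functor.map_comp]
      rfl)
  refine ⟨g, ?_⟩
  refine X.sheaf.eq_of_locally_eq' (fun y : U => f ⁻¹ᵁ W y) (f ⁻¹ᵁ U)
    (fun y => homOfLE (f.preimage_mono (hW y))) ?_ _ _ fun y => ?_
  · intro x hx
    exact TopologicalSpace.Opens.mem_iSup.mpr ⟨⟨f x, hx⟩, hyW ⟨f x, hx⟩⟩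
  · refine (hnat (hW y) g).symm.trans (Eq.trans ?_ (ht y))
    exact congrArg _ (hg y)

end

end AffineCoequalizer

/-! ### Flatness of free quotients and étale descent along the source -/

section AffineHom

theorem HasRingHomProperty.iff_app_of_isAffineHom (P : MorphismProperty Scheme.{u})
    {Q : ∀ {R S : Type u} [CommRing R] [CommRing S], (R →+* S) → Prop} [HasRingHomProperty P Q]
    {X Y : Scheme.{u}} (f : X ⟶ Y) [IsAffineHom f] :
    P f ↔ ∀ U : Y.Opens, IsAffineOpen U → Q (f.app U).hom := by
  have hQ := HasRingHomProperty.isLocal_ringHomProperty P (Q := Q)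
  have h1 := targetAffineLocally_affineAnd_iff' hQ.respectsIso f
  rw [targetAffineLocally_affineAnd_iff_affineLocally hQ f] at h1
  rw [HasRingHomProperty.eq_affineLocally P]
  simpa [show IsAffineHom f from inferInstance] using h1

theorem AlgebraicGeometry.Scheme.Hom.faithfullyFlat_app {X Y : Scheme.{u}} (f : X ⟶ Y)
    [IsAffineHom f] [Flat f] [Surjective f] {U : Y.Opens} (hU : IsAffineOpen U) :
    (f.app U).hom.FaithfullyFlat := by
  rw [RingHom.FaithfullyFlat.iff_flat_and_comap_surjective]
  refine ⟨(HasRingHomProperty.iff_app_of_isAffineHom @Flat f).mp ‹_› U hU, fun p => ?_⟩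
  obtain ⟨x, hx⟩ := f.surjective (hU.fromSpec p)
  have hxU : x ∈ f ⁻¹ᵁ U := by
    change f x ∈ U
    rw [hx, ← SetLike.mem_coe, ← hU.range_fromSpec]
    exact ⟨p, rfl⟩
  rw [← SetLike.mem_coe, ← (hU.preimage f).range_fromSpec] at hxU
  obtain ⟨q, rfl⟩ := hxU
  refine ⟨q, hU.fromSpec.isOpenEmbedding.injective ?_⟩
  have h := IsAffineOpen.SpecMap_appLE_fromSpec f hU (hU.preimage f) le_rfl
  rw [← Scheme.Hom.app_eq_appLE] at h
  rw [← hx, ← Scheme.Hom.comp_apply, ← h]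
  rfl

/-- Étaleness descends along étale surjective affine morphisms of the source. -/
theorem etale_of_etale_comp {X T Y : Scheme.{u}} (g : X ⟶ T) (h : T ⟶ Y) [IsAffineHom g]
    [Etale g] [Surjective g] [IsAffineHom h] [LocallyOfFinitePresentation h] [Etale (g ≫ h)] :
    Etale h := by
  rw [HasRingHomProperty.iff_app_of_isAffineHom @Etale h]
  intro U hU
  have h1 := (HasRingHomProperty.iff_app_of_isAffineHom @LocallyOfFinitePresentation h).mp ‹_› U hU
  have h2 := (HasRingHomProperty.iff_app_of_isAffineHom @Etale g).mp ‹_› _ (hU.preimage h)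
  have h3 := g.faithfullyFlat_app (hU.preimage h)
  have h4 : ((g.app (h ⁻¹ᵁ U)).hom.comp (h.app U).hom).Etale :=
    (HasRingHomProperty.iff_app_of_isAffineHom @Etale (g ≫ h)).mp ‹_› U hU
  generalize (h.app U).hom = φ at *
  generalize (g.app (h ⁻¹ᵁ U)).hom = ψ at *
  algebraize [φ, ψ, ψ.comp φ]
  exact Algebra.Etale.of_faithfullyFlat_of_etale Γ(Y, U) Γ(T, h ⁻¹ᵁ U) Γ(X, g ⁻¹ᵁ h ⁻¹ᵁ U)

end AffineHom

section GroupAction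

variable {S : Scheme.{u}} {X Y : Over S} {G : Subgroup (Aut X)} {π : X ⟶ Y}

/-- The action of a group `G` of automorphisms of `X` over `Y` on the sections of `X` over the
preimage of `U`, where `a ∈ G` acts by pullback along `a⁻¹`. -/
abbrev sectionsAction (hinv : ∀ a ∈ G, a.hom ≫ π = π) (U : Y.left.Opens) :
    MulSemiringAction G Γ(X.left, π.left ⁻¹ᵁ U) where
  smul a s := (a⁻¹ : G).1.hom.left.appLE (π.left ⁻¹ᵁ U) (π.left ⁻¹ᵁ U)
      (preimage_le_of_comp_eq (hinv _ (a⁻¹ : G).2) U) s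
  one_smul s := by
    have h : ((1 : G)⁻¹ : G).1.hom.left = 𝟙 X.left := by rw [inv_one]; rfl
    change Scheme.Hom.appLE _ _ _ _ s = s
    generalize_proofs hle
    revert hle
    rw [h]
    intro hle
    exact congr($(X.left.presheaf.map_id _) s)
  mul_smul a b s := by
    have h : ((a * b)⁻¹ : G).1.hom.left =
        (a⁻¹ : G).1.hom.left ≫ (b⁻¹ : G).1.hom.left := by
      rw [mul_inv_rev]; rfl
    change Scheme.Hom.appLE _ _ _ _ s =
      Scheme.Hom.appLE _ _ _ _ (Scheme.Hom.appLE _ _ _ _ s)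
    rw [← CommRingCat.comp_apply, Scheme.Hom.appLE_comp_appLE]
    generalize_proofs hle hle'
    revert hle
    rw [h]
    simp
  smul_zero _ := map_zero _
  smul_add _ := map_add _
  smul_one _ := map_one _
  smul_mul _ := map_mul _

variable (hinv : ∀ a ∈ G, a.hom ≫ π = π) (U : Y.left.Opens)

theorem smulCommClass_sectionsAction :
    letI := sectionsAction hinv U
    letI := (π.left.app U).hom.toAlgebra
    SMulCommClass G Γ(Y.left, U) Γ(X.left, π.left ⁻¹ᵁ U) := by
  let inst := sectionsAction hinv U
  let inst2 : Algebra Γ(Y.left, U) Γ(X.left, π.left ⁻¹ᵁ U) := (π.left.app U).hom.toAlgebra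
  refine ⟨fun a r s => ?_⟩
  rw [Algebra.smul_def, Algebra.smul_def, smul_mul']
  congr 1
  change (a⁻¹ : G).1.hom.left.appLE _ _ _ (π.left.app U r) = π.left.app U r
  rw [← CommRingCat.comp_apply, Scheme.Hom.app_eq_appLE, Scheme.Hom.appLE_comp_appLE]
  have h : (a⁻¹ : G).1.hom.left ≫ π.left = π.left :=
    congrArg CommaMorphism.left (hinv _ (a⁻¹ : G).2)
  generalize_proofs hle
  revert hle
  rw [h]
  simp

theorem isInvariant_sectionsAction
    (hex : ∀ s : Γ(X.left, π.left ⁻¹ᵁ U), (∀ (a : Aut X) (ha : a ∈ G),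
      a.hom.left.appLE (π.left ⁻¹ᵁ U) (π.left ⁻¹ᵁ U) (preimage_le_of_comp_eq (hinv a ha) U) s = s) →
      ∃ t, π.left.app U t = s) :
    letI := sectionsAction hinv U
    letI := (π.left.app U).hom.toAlgebra
    Algebra.IsInvariant Γ(Y.left, U) Γ(X.left, π.left ⁻¹ᵁ U) G := by
  let inst := sectionsAction hinv U
  let inst2 : Algebra Γ(Y.left, U) Γ(X.left, π.left ⁻¹ᵁ U) := (π.left.app U).hom.toAlgebra
  refine ⟨fun s hs => hex s fun a ha => ?_⟩
  have h : ((⟨a, ha⟩⁻¹ : G)⁻¹ : G).1.hom.left.appLE (π.left ⁻¹ᵁ U) (π.left ⁻¹ᵁ U)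
    (preimage_le_of_comp_eq (hinv _ ((⟨a, ha⟩⁻¹ : G)⁻¹ : G).2) U) s = s := hs (⟨a, ha⟩⁻¹ : G)
  generalize_proofs hle at h
  revert hle h
  rw [inv_inv]
  exact fun _ h => h

variable {U}

/-- If the sections of `Y` over an affine open set `U` are the invariant sections of `X`, then the
finite group `G` acts transitively on the fibres over `U`. -/
theorem exists_apply_eq_of_exists_app_eq [Finite G] [IsAffineHom π.left] (hU : IsAffineOpen U)
    (hex : ∀ s : Γ(X.left, π.left ⁻¹ᵁ U), (∀ (a : Aut X) (ha : a ∈ G),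
      a.hom.left.appLE (π.left ⁻¹ᵁ U) (π.left ⁻¹ᵁ U) (preimage_le_of_comp_eq (hinv a ha) U) s = s) →
      ∃ t, π.left.app U t = s) {x y : X.left} (hx : π.left x ∈ U) (hxy : π.left x = π.left y) :
    ∃ a ∈ G, a.hom.left x = y := by
  let inst := sectionsAction hinv U
  let inst2 : Algebra Γ(Y.left, U) Γ(X.left, π.left ⁻¹ᵁ U) := (π.left.app U).hom.toAlgebra
  have := smulCommClass_sectionsAction hinv U
  have := isInvariant_sectionsAction hinv U hex
  have hV := hU.preimage π.left
  have hmem {z : X.left} (hz : π.left z ∈ U) : ∃ p, hV.fromSpec p = z := by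
    have : z ∈ Set.range hV.fromSpec := by
      rw [hV.range_fromSpec]
      exact hz
    exact this
  obtain ⟨p, rfl⟩ := hmem hx
  obtain ⟨q, rfl⟩ := hmem (hxy ▸ hx)
  have hunder : PrimeSpectrum.comap (π.left.app U).hom p =
      PrimeSpectrum.comap (π.left.app U).hom q := by
    apply hU.fromSpec.isOpenEmbedding.injective
    have h := IsAffineOpen.SpecMap_appLE_fromSpec π.left hU hV le_rfl
    rw [← Scheme.Hom.app_eq_appLE] at h
    have h' (z : Spec Γ(X.left, π.left ⁻¹ᵁ U)) :
        hU.fromSpec (Spec.map (π.left.app U) z) = π.left (hV.fromSpec z) := by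
      rw [← Scheme.Hom.comp_apply, h, Scheme.Hom.comp_apply]
    exact (h' p).trans (hxy.trans (h' q).symm)
  obtain ⟨a, ha⟩ := Algebra.IsInvariant.exists_smul_of_under_eq Γ(Y.left, U)
    Γ(X.left, π.left ⁻¹ᵁ U) G p.asIdeal q.asIdeal
    (hP := PrimeSpectrum.isPrime p) (hQ := PrimeSpectrum.isPrime q) (congrArg PrimeSpectrum.asIdeal hunder)
  refine ⟨a, a.2, ?_⟩
  have h := IsAffineOpen.SpecMap_appLE_fromSpec a.1.hom.left hV hV
    (preimage_le_of_comp_eq (hinv _ a.2) U)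
  rw [← Scheme.Hom.comp_apply, ← h, Scheme.Hom.comp_apply]
  congr 1
  refine PrimeSpectrum.ext (Eq.trans ?_ ha.symm)
  ext s
  rw [Ideal.mem_pointwise_smul_iff_inv_smul_mem]
  change a.1.hom.left.appLE _ _ _ s ∈ p.asIdeal ↔
    ((a⁻¹ : G)⁻¹ : G).1.hom.left.appLE _ _ _ s ∈ p.asIdeal
  generalize_proofs hle hle'
  revert hle'
  rw [inv_inv]
  exact fun _ => Iff.rfl

/-- The quotient of a scheme by a finite group that acts freely is flat. -/
theorem IsGeometricQuotient.flat [Finite G] (hπ : IsGeometricQuotient G π) [IsAffineHom π.left]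
    (hfree : ∀ a ∈ G, ∀ (F : Type u) [Field F] (x : Spec (.of F) ⟶ X.left),
      x ≫ a.hom.left = x → a = 1) : Flat π.left := by
  rw [HasRingHomProperty.iff_app_of_isAffineHom @Flat π.left]
  intro U hU
  let inst := sectionsAction hπ.invariant U
  let inst2 : Algebra Γ(Y.left, U) Γ(X.left, π.left ⁻¹ᵁ U) := (π.left.app U).hom.toAlgebra
  have := smulCommClass_sectionsAction hπ.invariant U
  have := isInvariant_sectionsAction hπ.invariant U (hπ.exists_app_eq U)
  have : FaithfulSMul Γ(Y.left, U) Γ(X.left, π.left ⁻¹ᵁ U) :=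
    (faithfulSMul_iff_algebraMap_injective _ _).mpr (hπ.app_injective U)
  have : Module.Projective Γ(Y.left, U) Γ(X.left, π.left ⁻¹ᵁ U) := by
    refine Module.Projective.of_isInvariant_of_free (G := G) fun m hm a ha => ?_
    by_contra! hcon
    let _ := Ideal.Quotient.field m
    refine ha (inv_injective (Eq.trans (Subtype.ext ?_) inv_one.symm))
    have hV := hU.preimage π.left
    -- If `a` acts trivially modulo `m`, then `a⁻¹` fixes the point of `X` with residue field
    -- `Γ(X, π⁻¹ U) / m`.
    refine hfree _ (a⁻¹ : G).2 (Γ(X.left, π.left ⁻¹ᵁ U) ⧸ m)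
      (Spec.map (CommRingCat.ofHom (Ideal.Quotient.mk m)) ≫ hV.fromSpec) ?_
    rw [Category.assoc, ← IsAffineOpen.SpecMap_appLE_fromSpec _ hV hV
      (preimage_le_of_comp_eq (hπ.invariant _ (a⁻¹ : G).2) U), ← Category.assoc, ← Spec.map_comp]
    congr 2
    ext s
    exact Ideal.Quotient.eq.mpr (hcon s)
  change Module.Flat _ _
  infer_instance

end GroupAction

/-! ### Points with values in an extension field -/

section FieldPoints

/-- A `K`-rational point of a `K`-scheme is determined by its image. -/
theorem eq_of_comp_eq_id_of_apply_eq {K : Type u} [Field K] {X : Scheme.{u}}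
    (s : X ⟶ Spec (.of K)) {x y : Spec (.of K) ⟶ X} (hx : x ≫ s = 𝟙 _) (hy : y ≫ s = 𝟙 _)
    (h : x (IsLocalRing.closedPoint K) = y (IsLocalRing.closedPoint K)) : x = y := by
  obtain ⟨⟨p, φ⟩, rfl⟩ := (Scheme.SpecToEquivOfField K X).symm.surjective x
  obtain ⟨⟨q, ψ⟩, rfl⟩ := (Scheme.SpecToEquivOfField K X).symm.surjective y
  simp only [Scheme.SpecToEquivOfField_symm_apply] at hx hy h ⊢
  obtain rfl : p = q :=
    (X.fromSpecResidueField_apply p _).symm.trans (h.trans (X.fromSpecResidueField_apply q _))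
  obtain ⟨α, hα⟩ := Spec.map_surjective (X.fromSpecResidueField p ≫ s)
  have key : ∀ θ : X.residueField p ⟶ .of K,
      (Spec.map θ ≫ X.fromSpecResidueField p) ≫ s = 𝟙 _ → α ≫ θ = 𝟙 _ := by
    intro θ hθ
    rw [Category.assoc, ← hα, ← Spec.map_comp, ← Spec.map_id] at hθ
    exact Spec.map_injective hθ
  have hφ := key φ hx
  have hψ := key ψ hy
  have : IsIso φ := by
    rw [ConcreteCategory.isIso_iff_bijective]
    refine ⟨φ.hom.injective, fun c => ⟨α c, ?_⟩⟩
    rw [← CommRingCat.comp_apply, hφ]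
    rfl
  have hα' : IsIso α := by
    rw [← IsIso.eq_comp_inv, Category.id_comp] at hφ
    rw [hφ]
    infer_instance
  rw [(cancel_epi α).mp (hφ.trans hψ.symm)]

variable {k K : Type u} [Field k] [Field K] [Algebra k K]

/-- A `K`-valued point that is fixed by an automorphism `σ` of `K` with fixed field `k` is
defined over `k`. -/
theorem exists_specExt_comp_eq {σ : K ≃ₐ[k] K} (hσ : ∀ c, σ c = c → c ∈ Set.range (algebraMap k K))
    {X : Scheme.{u}} {x : Spec (.of K) ⟶ X} (hx : specGal σ ≫ x = x) :
    ∃ P : Spec (.of k) ⟶ X, specExt k K ≫ P = x := by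
  obtain ⟨⟨p, φ⟩, rfl⟩ := (Scheme.SpecToEquivOfField K X).symm.surjective x
  simp only [Scheme.SpecToEquivOfField_symm_apply] at hx ⊢
  rw [← Category.assoc, cancel_mono, ← Spec.map_comp] at hx
  have hφ : φ ≫ CommRingCat.ofHom (σ : K →+* K) = φ := Spec.map_injective hx
  have hinj : Function.Injective (algebraMap k K) := (algebraMap k K).injective
  have hmem : ∀ c, φ c ∈ (algebraMap k K).range := fun c => hσ _ congr($hφ c)
  let e := RingEquiv.ofBijective (algebraMap k K).rangeRestrict
    ⟨fun a b h => hinj (congrArg Subtype.val h), (algebraMap k K).rangeRestrict_surjective⟩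
  let ψ : X.residueField p ⟶ .of k :=
    CommRingCat.ofHom ((e.symm : _ →+* k).comp (φ.hom.codRestrict (algebraMap k K).range hmem))
  have hψ : ψ ≫ CommRingCat.ofHom (algebraMap k K) = φ := by
    ext c
    exact congrArg Subtype.val (e.apply_symm_apply ⟨φ c, hmem c⟩)
  refine ⟨Spec.map ψ ≫ X.fromSpecResidueField p, ?_⟩
  rw [← Category.assoc, ← Spec.map_comp, hψ]

instance : Epi (specExt k K) := by
  have : Flat (specExt k K) := inferInstance
  have : Surjective (specExt k K) := inferInstance
  exact Flat.epi_of_flat_of_surjective _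

theorem FiniteField.mem_range_algebraMap_of_frobenius_eq [Fintype k] [Algebra.IsAlgebraic k K]
    {c : K} (hc : FiniteField.frobeniusAlgEquivOfAlgebraic k K c = c) :
    c ∈ Set.range (algebraMap k K) := by
  classical
  have hne : (Polynomial.X ^ Fintype.card k - Polynomial.X : Polynomial K) ≠ 0 :=
    FiniteField.X_pow_card_sub_X_ne_zero K Fintype.one_lt_card
  have hroot (x : K) : x ∈ (Polynomial.X ^ Fintype.card k - Polynomial.X : Polynomial K).roots ↔
      x ^ Fintype.card k = x := by
    simp [Polynomial.mem_roots hne, sub_eq_zero]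
  -- The polynomial `X ^ q - X` has at most `q` roots in `K`, and the elements of `k` are roots.
  have heq : Finset.univ.image (algebraMap k K) =
      (Polynomial.X ^ Fintype.card k - Polynomial.X : Polynomial K).roots.toFinset := by
    refine Finset.eq_of_subset_of_card_le ?_ ?_
    · intro x hx
      obtain ⟨a, -, rfl⟩ := Finset.mem_image.mp hx
      rw [Multiset.mem_toFinset, hroot, ← map_pow, FiniteField.pow_card]
    · rw [Finset.card_image_of_injective _ (algebraMap k K).injective, Finset.card_univ]
      refine (Multiset.toFinset_card_le _).trans ((Polynomial.card_roots' _).trans ?_)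
      rw [FiniteField.X_pow_card_sub_X_natDegree_eq K Fintype.one_lt_card]
  have hc' : c ∈ Finset.univ.image (algebraMap k K) := by
    rw [heq, Multiset.mem_toFinset, hroot]
    exact hc
  obtain ⟨a, -, ha⟩ := Finset.mem_image.mp hc'
  exact ⟨a, ha⟩

end FieldPoints

/-! ### Base change of morphisms -/

section BaseChange

variable {k : Type u} [Field k] (K : Type u) [Field K] [Algebra k K]

theorem isPullback_extendScalarsMapLeft {X Y : SchemeOver k} (f : X ⟶ Y) :
    IsPullback (pullback.fst X.hom (specExt k K)) (extendScalarsMapLeft K f) f.left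
      (pullback.fst Y.hom (specExt k K)) := by
  refine IsPullback.of_bot ?_ (extendScalarsMapLeft_fst K f).symm
    (IsPullback.of_hasPullback Y.hom (specExt k K))
  rw [extendScalarsMapLeft_snd, Over.w]
  exact IsPullback.of_hasPullback X.hom (specExt k K)

theorem extendScalarsMapLeft_of_isStableUnderBaseChange (P : MorphismProperty Scheme.{u})
    [P.IsStableUnderBaseChange] {X Y : SchemeOver k} {f : X ⟶ Y} (hf : P f.left) :
    P (extendScalarsMap K f).left :=
  P.of_isPullback (isPullback_extendScalarsMapLeft K f) hf

theorem extendScalars_hom_of_isStableUnderBaseChange (P : MorphismProperty Scheme.{u})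
    [P.IsStableUnderBaseChange] {X : SchemeOver k} (hX : P X.hom) :
    P (extendScalars K X).hom :=
  P.pullback_snd _ _ hX

theorem extendScalarsMap_comp {X Y Z : SchemeOver k} (f : X ⟶ Y) (g : Y ⟶ Z) :
    extendScalarsMap K (f ≫ g) = extendScalarsMap K f ≫ extendScalarsMap K g := by
  ext : 1
  change extendScalarsMapLeft K (f ≫ g) = extendScalarsMapLeft K f ≫ extendScalarsMapLeft K g
  apply pullback.hom_ext
  · rw [extendScalarsMapLeft_fst, Category.assoc, extendScalarsMapLeft_fst, Over.comp_left,
      reassoc_of% extendScalarsMapLeft_fst K f]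
  · rw [extendScalarsMapLeft_snd, Category.assoc, extendScalarsMapLeft_snd,
      extendScalarsMapLeft_snd]

end BaseChange

/-! ### Geometric points and the Galois action on them -/

noncomputable section GeometricPoints

variable {k : Type u} [Field k] {K : Type u} [Field K] [Algebra k K] {X Y : SchemeOver k}

/-- The action of `τ ∈ Gal(K/k)` on the `K`-rational points of `X_K`. -/
def galPoint (τ : K ≃ₐ[k] K) (y : RationalPoint (extendScalars K X)) :
    RationalPoint (extendScalars K X) :=
  Over.homMk (specGal τ ≫ y.left ≫ semilinear X τ⁻¹) (by
    have h : y.left ≫ pullback.snd X.hom (specExt k K) = 𝟙 _ := Over.w y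
    simp only [Over.mk_left, Over.mk_hom, Category.assoc]
    rw [semilinear_snd, reassoc_of% h, specGal_comp_inv])

theorem galPoint_comp_map (τ : K ≃ₐ[k] K) (f : X ⟶ Y) (y : RationalPoint (extendScalars K X)) :
    galPoint τ (y ≫ extendScalarsMap K f) = galPoint τ y ≫ extendScalarsMap K f := by
  ext : 1
  simp [galPoint, semilinear_naturality]

theorem galPoint_comp_hom (τ : K ≃ₐ[k] K) (a : Aut (extendScalars K X))
    (y : RationalPoint (extendScalars K X)) :
    galPoint τ (y ≫ a.hom) = galPoint τ y ≫ (galConj X τ a).hom := by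
  ext : 1
  change specGal τ ≫ (y.left ≫ a.hom.left) ≫ semilinear X τ⁻¹ =
    (specGal τ ≫ y.left ≫ semilinear X τ⁻¹) ≫ semilinear X τ ≫ a.hom.left ≫ semilinear X τ⁻¹
  simp [reassoc_of% semilinear_inv_comp X τ]

variable (K) in
/-- The `K`-rational point of `X_K` defined by a `k`-rational point of `X`. -/
def geometricPoint (P : RationalPoint X) : RationalPoint (extendScalars K X) :=
  Over.homMk (pullback.lift (f := X.hom) (g := specExt k K) (specExt k K ≫ P.left) (𝟙 _) (by
    have h : P.left ≫ X.hom = 𝟙 _ := Over.w P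
    rw [Category.assoc, h]
    exact (Category.comp_id _).trans (Category.id_comp _).symm)) (pullback.lift_snd _ _ _)

theorem geometricPoint_left_fst (P : RationalPoint X) :
    (geometricPoint K P).left ≫ pullback.fst X.hom (specExt k K) = specExt k K ≫ P.left :=
  pullback.lift_fst _ _ _

theorem RationalPoint.ext_fst {y z : RationalPoint (extendScalars K X)}
    (h : y.left ≫ pullback.fst X.hom (specExt k K) = z.left ≫ pullback.fst X.hom (specExt k K)) :
    y = z := by
  ext : 1
  apply pullback.hom_ext h
  exact (Over.w y).trans (Over.w z).symm

theorem geometricPoint_injective : Function.Injective (geometricPoint K (X := X)) := by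
  intro P Q h
  ext : 1
  rw [← cancel_epi (specExt k K), ← geometricPoint_left_fst, h, geometricPoint_left_fst]

theorem geometricPoint_comp (f : X ⟶ Y) (P : RationalPoint X) :
    geometricPoint K (P ≫ f) = geometricPoint K P ≫ extendScalarsMap K f := by
  apply RationalPoint.ext_fst
  rw [geometricPoint_left_fst, Over.comp_left, Over.comp_left, Category.assoc]
  erw [extendScalarsMapLeft_fst]
  rw [reassoc_of% geometricPoint_left_fst P]

theorem galPoint_left_fst (τ : K ≃ₐ[k] K) (y : RationalPoint (extendScalars K X)) :
    (galPoint τ y).left ≫ pullback.fst X.hom (specExt k K) =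
      specGal τ ≫ y.left ≫ pullback.fst X.hom (specExt k K) := by
  change (specGal τ ≫ y.left ≫ semilinear X τ⁻¹) ≫ _ = _
  rw [Category.assoc, Category.assoc, semilinear_fst]

theorem galPoint_geometricPoint (τ : K ≃ₐ[k] K) (P : RationalPoint X) :
    galPoint τ (geometricPoint K P) = geometricPoint K P := by
  apply RationalPoint.ext_fst
  rw [galPoint_left_fst, geometricPoint_left_fst, reassoc_of% specGal_comp_specExt τ]

/-- A `K`-rational point is `k`-rational if it is fixed by an automorphism with fixed field `k`. -/
theorem exists_geometricPoint_eq {σ : K ≃ₐ[k] K}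
    (hσ : ∀ c, σ c = c → c ∈ Set.range (algebraMap k K)) {y : RationalPoint (extendScalars K X)}
    (hy : galPoint σ y = y) : ∃ P, geometricPoint K P = y := by
  obtain ⟨P, hP⟩ := exists_specExt_comp_eq hσ (x := y.left ≫ pullback.fst X.hom (specExt k K))
    (by rw [← galPoint_left_fst, hy])
  have hPX : P ≫ X.hom = 𝟙 _ := by
    have h : y.left ≫ pullback.snd X.hom (specExt k K) = 𝟙 _ := Over.w y
    rw [← cancel_epi (specExt k K), reassoc_of% hP, pullback.condition, reassoc_of% h,
      Category.comp_id]
  refine ⟨Over.homMk P hPX, RationalPoint.ext_fst ?_⟩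
  rw [geometricPoint_left_fst]
  exact hP

end GeometricPoints

/-! ### Rigidity of unramified covers -/

/-- Two lifts of a morphism from a connected scheme along a separated unramified morphism agree if
they agree somewhere: the diagonal is an open and closed immersion. -/
theorem eq_of_formallyUnramified_of_comp_eq {X Y Z T : Scheme.{u}} (f : X ⟶ Y)
    [FormallyUnramified f] [LocallyOfFiniteType f] [IsSeparated f] [PreconnectedSpace Z]
    [Nonempty T] {v w : Z ⟶ X} (h : v ≫ f = w ≫ f) (x : T ⟶ Z) (hx : x ≫ v = x ≫ w) : v = w := by
  let d := pullback.lift v w h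
  let j := pullback.snd (pullback.diagonal f) d
  have hj : IsClosedImmersion j := inferInstance
  have hne : (Set.range j).Nonempty := by
    obtain ⟨t⟩ := ‹Nonempty T›
    have hlift : (x ≫ v) ≫ pullback.diagonal f = x ≫ d := by
      apply pullback.hom_ext
      · rw [Category.assoc, Category.assoc, pullback.diagonal_fst, Category.comp_id]
        exact congrArg _ (pullback.lift_fst _ _ _).symm
      · rw [Category.assoc, Category.assoc, pullback.diagonal_snd, Category.comp_id, hx]
        exact congrArg _ (pullback.lift_snd _ _ _).symm
    exact ⟨_, pullback.lift (x ≫ v) x hlift t, rfl⟩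
  have hrange : Set.range j = Set.univ :=
    IsClopen.eq_univ ⟨j.isClosedEmbedding.isClosed_range, j.isOpenEmbedding.isOpen_range⟩ hne
  have : IsIso j := isIso_of_isOpenImmersion_of_opensRange_eq_top j
    (TopologicalSpace.Opens.ext hrange)
  have hcond : pullback.fst (pullback.diagonal f) d ≫ pullback.diagonal f = j ≫ d :=
    pullback.condition
  have h1 := congrArg (· ≫ pullback.fst f f) hcond
  have h2 := congrArg (· ≫ pullback.snd f f) hcond
  simp only [Category.assoc, pullback.diagonal_fst, pullback.diagonal_snd, d, pullback.lift_fst,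
    pullback.lift_snd] at h1 h2
  rw [← cancel_epi j, ← h1, h2]

noncomputable section RationalPoints

variable {K : Type u} [Field K] {X Y : SchemeOver K}

/-- The image of a rational point, as a point of the underlying topological space. -/
def RationalPoint.point (y : RationalPoint X) : X.left :=
  (show Spec (.of K) ⟶ X.left from y.left) (IsLocalRing.closedPoint K)

theorem RationalPoint.point_comp (y : RationalPoint X) (π : X ⟶ Y) :
    RationalPoint.point (y ≫ π) = π.left (RationalPoint.point y) :=
  rfl

theorem RationalPoint.point_injective :
    Function.Injective (RationalPoint.point (X := X)) := by
  intro y z h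
  ext1
  exact eq_of_comp_eq_id_of_apply_eq X.hom (Over.w y) (Over.w z) h

theorem RationalPoint.isClosed_point [IsSeparated X.hom] (y : RationalPoint X) :
    IsClosed {RationalPoint.point y} := by
  let y' : Spec (.of K) ⟶ X.left := y.left
  have hy' : y' ≫ X.hom = 𝟙 _ := Over.w y
  have := isClosedImmersion_of_comp_eq_id _ _ hy'
  have h := y'.isClosedEmbedding.isClosed_range
  rwa [Set.range_eq_singleton (y := RationalPoint.point y)] at h
  exact fun x => congrArg y' (Subsingleton.elim x _)

theorem RationalPoint.exists_point_eq [IsAlgClosed K] [LocallyOfFiniteType X.hom] {x : X.left}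
    (hx : IsClosed {x}) : ∃ y : RationalPoint X, RationalPoint.point y = x :=
  ⟨Over.homMk (pointOfClosedPoint X.hom x hx) (pointOfClosedPoint_comp X.hom x hx),
    pointOfClosedPoint_apply X.hom x hx _⟩

end RationalPoints

section Cover

variable {k : Type u} [Field k] {K : Type u} [Field K] [Algebra k K] {C' C : SchemeOver k}
  {f : C' ⟶ C}

theorem IsSmoothProjectiveCurve.isIntegral_extendScalars {X : SchemeOver k}
    (hX : IsSmoothProjectiveCurve X) (K : Type u) [Field K] [Algebra k K] :
    IsIntegral (extendScalars K X).left :=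
  hX.geometricallyIntegral.geometrically_isIntegral _ _ _ (IsPullback.of_hasPullback _ _)

theorem IsSmoothProjectiveCurve.isProper_extendScalars {X : SchemeOver k}
    (hX : IsSmoothProjectiveCurve X) (K : Type u) [Field K] [Algebra k K] :
    IsProper (extendScalars K X).hom :=
  extendScalars_hom_of_isStableUnderBaseChange K @IsProper hX.proper

/-- An automorphism of an unramified abelian cover that fixes a point with values in a nonempty
scheme is trivial. -/
theorem IsUnramifiedAbelianCover.eq_one_of_comp_eq (hf : IsUnramifiedAbelianCover K f)
    {a : Aut (extendScalars K C')} (ha : a ∈ deckGroup K f) {T : Scheme.{u}} [Nonempty T]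
    (x : T ⟶ (extendScalars K C').left) (hx : x ≫ a.hom.left = x) : a = 1 := by
  have := hf.isCurve_source.isIntegral_extendScalars K
  have : FormallyUnramified (extendScalarsMap K f).left :=
    extendScalarsMapLeft_of_isStableUnderBaseChange K @FormallyUnramified hf.unramified
  have : IsFinite (extendScalarsMap K f).left :=
    extendScalarsMapLeft_of_isStableUnderBaseChange K @IsFinite hf.isFinite
  have ha' : a.hom.left ≫ (extendScalarsMap K f).left = (extendScalarsMap K f).left :=
    congrArg CommaMorphism.left ha
  ext1
  ext1
  exact eq_of_formallyUnramified_of_comp_eq (w := 𝟙 _) (extendScalarsMap K f).left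
    (ha'.trans (Category.id_comp _).symm) x (hx.trans (Category.comp_id _).symm)

theorem IsUnramifiedAbelianCover.comp_hom_injective (hf : IsUnramifiedAbelianCover K f)
    (y : RationalPoint (extendScalars K C')) :
    Function.Injective fun a : deckGroup K f => y ≫ a.1.hom := by
  intro a b hab
  rw [← inv_mul_eq_one]
  have h : y ≫ (a⁻¹ * b : deckGroup K f).1.hom = y := by
    exact (Category.assoc _ _ _).symm.trans ((Iso.comp_inv_eq a.1).mpr hab.symm)
  exact Subtype.ext (hf.eq_one_of_comp_eq (a⁻¹ * b).2 (T := Spec (.of K)) y.left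
    (congrArg CommaMorphism.left h))

/-- The group acts transitively on the `K`-rational points of the fibres of a quotient. -/
theorem IsGeometricQuotient.exists_comp_hom_eq {X Y : SchemeOver K} {G : Subgroup (Aut X)}
    {π : X ⟶ Y} (hπ : IsGeometricQuotient G π) {y z : RationalPoint X} (h : y ≫ π = z ≫ π) :
    ∃ a ∈ G, y ≫ a.hom = z := by
  obtain ⟨a, ha, haz⟩ := hπ.orbit (RationalPoint.point y) (RationalPoint.point z)
    (congrArg RationalPoint.point h)
  exact ⟨a, ha, RationalPoint.point_injective haz⟩

/-- A quotient map that is part of a finite morphism is surjective on rational points over an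
algebraically closed field. -/
theorem IsGeometricQuotient.exists_comp_eq [IsAlgClosed K] {X Y Z : SchemeOver K}
    {G : Subgroup (Aut X)} {π : X ⟶ Z} (hπ : IsGeometricQuotient G π) (h : Z ⟶ Y)
    [IsFinite (π ≫ h).left] [LocallyOfFiniteType X.hom] [IsSeparated Y.hom]
    (q : RationalPoint Z) : ∃ y : RationalPoint X, y ≫ π = q := by
  obtain ⟨x, hx⟩ := hπ.isQuotientMap.surjective (RationalPoint.point q)
  have hxr : (π ≫ h).left x = RationalPoint.point (q ≫ h) := by
    rw [RationalPoint.point_comp, ← hx]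
    rfl
  have hclosed := (RationalPoint.isClosed_point (q ≫ h)).preimage (π ≫ h).left.continuous
  have hdisc := (π ≫ h).left.isDiscrete_preimage_singleton (RationalPoint.point (q ≫ h))
  have hxc : IsClosed {x} := by
    rw [← closure_subset_iff_isClosed]
    intro z hz
    have hz' := closure_minimal (s := {x}) (Set.singleton_subset_iff.mpr hxr) hclosed hz
    exact (hdisc.eq_of_specializes (specializes_iff_mem_closure.mpr hz) hxr hz').symm
  obtain ⟨y, rfl⟩ := RationalPoint.exists_point_eq hxc
  exact ⟨y, RationalPoint.point_injective hx⟩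

/-- The group `A` acts freely on the finite fibre of `f_K` through a rational point. -/
theorem IsUnramifiedAbelianCover.finite_deckGroup [IsAlgClosed K]
    (hf : IsUnramifiedAbelianCover K f) : Finite (deckGroup K f) := by
  have := hf.isCurve_source.isIntegral_extendScalars K
  have := hf.isCurve_source.isProper_extendScalars K
  have : IsFinite (extendScalarsMap K f).left :=
    extendScalarsMapLeft_of_isStableUnderBaseChange K @IsFinite hf.isFinite
  have : CompactSpace (extendScalars K C').left :=
    QuasiCompact.compactSpace_of_compactSpace (extendScalars K C').hom
  obtain ⟨x, -, hx⟩ := (isClosed_univ (X := (extendScalars K C').left)).exists_closed_singleton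
    Set.univ_nonempty
  obtain ⟨y, rfl⟩ := RationalPoint.exists_point_eq hx
  have hfin := (extendScalarsMap K f).left.finite_preimage_singleton
    ((extendScalarsMap K f).left (RationalPoint.point y))
  have := hfin.to_subtype
  refine Finite.of_injective (fun a : deckGroup K f =>
    (⟨RationalPoint.point (y ≫ a.1.hom), ?_⟩ : (extendScalarsMap K f).left ⁻¹'
      {(extendScalarsMap K f).left (RationalPoint.point y)})) ?_
  · rw [Set.mem_preimage, Set.mem_singleton_iff, ← RationalPoint.point_comp, Category.assoc, a.2]
    rfl
  · intro a b hab
    exact hf.comp_hom_injective y (RationalPoint.point_injective (congrArg Subtype.val hab))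

end Cover

/-! ### The Galois action on the group of the cover -/

section GaloisAction

variable {k : Type u} [Field k] {K : Type u} [Field K] [Algebra k K]

theorem semilinear_mul (X : SchemeOver k) (τ υ : K ≃ₐ[k] K) :
    semilinear X (τ * υ) = semilinear X τ ≫ semilinear X υ := by
  have h : specGal (τ * υ) = specGal τ ≫ specGal υ := by
    rw [← Spec.map_comp, ← CommRingCat.ofHom_comp]
    rfl
  apply pullback.hom_ext
  · rw [Category.assoc, semilinear_fst, semilinear_fst, semilinear_fst]
  · rw [Category.assoc, semilinear_snd, semilinear_snd, reassoc_of% semilinear_snd X τ, h]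

theorem galConj_mul (X : SchemeOver k) (τ υ : K ≃ₐ[k] K) (a : Aut (extendScalars K X)) :
    galConj X (τ * υ) a = galConj X τ (galConj X υ a) := by
  ext1
  ext1
  change semilinear X (τ * υ) ≫ a.hom.left ≫ semilinear X (τ * υ)⁻¹ =
    semilinear X τ ≫ (semilinear X υ ≫ a.hom.left ≫ semilinear X υ⁻¹) ≫ semilinear X τ⁻¹
  rw [mul_inv_rev, semilinear_mul, semilinear_mul]
  simp only [Category.assoc]

theorem galConj_one (X : SchemeOver k) (a : Aut (extendScalars K X)) :
    galConj X (1 : K ≃ₐ[k] K) a = a := by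
  have h : semilinear X (1 : K ≃ₐ[k] K) = 𝟙 _ := by
    have := semilinear_comp_inv X (1 : K ≃ₐ[k] K)
    rwa [inv_one, ← semilinear_mul, one_mul] at this
  ext1
  ext1
  change semilinear X (1 : K ≃ₐ[k] K) ≫ a.hom.left ≫ semilinear X (1 : K ≃ₐ[k] K)⁻¹ = _
  rw [inv_one, h, Category.id_comp]
  exact Category.comp_id _

theorem deckGal_mul {X Y : SchemeOver k} (f : X ⟶ Y) (τ υ : K ≃ₐ[k] K) (a : deckGroup K f) :
    deckGal f (τ * υ) a = deckGal f τ (deckGal f υ a) :=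
  Subtype.ext (galConj_mul X τ υ a.1)

theorem deckGal_one {X Y : SchemeOver k} (f : X ⟶ Y) (a : deckGroup K f) :
    deckGal f (1 : K ≃ₐ[k] K) a = a :=
  Subtype.ext (galConj_one X a.1)

variable [Fintype k] [Algebra.IsAlgebraic k K]

/-- The Frobenius automorphism is central in the Galois group. -/
theorem FiniteField.mul_frobeniusAlgEquivOfAlgebraic_comm (τ : K ≃ₐ[k] K) :
    τ * FiniteField.frobeniusAlgEquivOfAlgebraic k K =
      FiniteField.frobeniusAlgEquivOfAlgebraic k K * τ := by
  ext c
  exact map_pow τ c _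

theorem isDefinedOverBase_frobeniusSubgroup {X Y : SchemeOver k} (f : X ⟶ Y)
    (hA : ∀ a b : deckGroup K f, a * b = b * a) :
    IsDefinedOverBase f (frobeniusSubgroup K f hA) := by
  have hle (τ : K ≃ₐ[k] K) {b : deckGroup K f} (hb : b ∈ frobeniusSubgroup K f hA) :
      deckGal f τ b ∈ frobeniusSubgroup K f hA := by
    obtain ⟨a, rfl⟩ := hb
    refine ⟨deckGal f τ a, ?_⟩
    rw [map_mul, map_inv, ← deckGal_mul, ← deckGal_mul,
      FiniteField.mul_frobeniusAlgEquivOfAlgebraic_comm]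
  intro τ
  apply le_antisymm
  · rintro _ ⟨b, hb, rfl⟩
    exact hle τ hb
  · intro b hb
    refine ⟨deckGal f τ⁻¹ b, hle _ hb, ?_⟩
    rw [← deckGal_mul, mul_inv_cancel, deckGal_one]

end GaloisAction

/-! ### Rational points -/

section Points

variable {k : Type u} [Field k] {K : Type u} [Field K] [Algebra k K] {C' C CB : SchemeOver k}
  {f : C' ⟶ C}

theorem deckGroup.comp_hom_comp_map (a : deckGroup K f) (y : RationalPoint (extendScalars K C')) :
    (y ≫ a.1.hom) ≫ extendScalarsMap K f = y ≫ extendScalarsMap K f :=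
  (Category.assoc _ _ _).trans (congrArg _ a.2)

/-- If `P₀` is a `k`-rational point, then the translate of `P₀` by `a ∈ A` is moved by `τ` to the
translate by `τ(a)`. -/
theorem galPoint_geometricPoint_comp_hom (τ : K ≃ₐ[k] K) (P₀ : RationalPoint C')
    (a : deckGroup K f) : galPoint τ (geometricPoint K P₀ ≫ a.1.hom) =
      geometricPoint K P₀ ≫ (deckGal f τ a).1.hom := by
  rw [galPoint_comp_hom, galPoint_geometricPoint]
  rfl

theorem IsUnramifiedAbelianCover.exists_comp_hom_eq (hf : IsUnramifiedAbelianCover K f)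
    {y z : RationalPoint (extendScalars K C')}
    (h : y ≫ extendScalarsMap K f = z ≫ extendScalarsMap K f) :
    ∃ a : deckGroup K f, y ≫ a.1.hom = z := by
  obtain ⟨a, ha, haz⟩ := hf.isGeometricQuotient.exists_comp_hom_eq h
  exact ⟨⟨a, ha⟩, haz⟩

theorem IsQuotientModel.comp_eq_comp_iff {B : Subgroup (deckGroup K f)} {g : C' ⟶ CB}
    {h : CB ⟶ C} (hg : IsQuotientModel f B g h) {y z : RationalPoint (extendScalars K C')} :
    y ≫ extendScalarsMap K g = z ≫ extendScalarsMap K g ↔ ∃ b ∈ B, y ≫ b.1.hom = z := by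
  constructor
  · intro hyz
    obtain ⟨_, ⟨b, hb, rfl⟩, hbz⟩ := hg.isGeometricQuotient.exists_comp_hom_eq hyz
    exact ⟨b, hb, hbz⟩
  · rintro ⟨b, hb, rfl⟩
    exact ((Category.assoc _ _ _).trans (congrArg _
      (hg.isGeometricQuotient.invariant b.1 ⟨b, hb, rfl⟩))).symm

variable [Fintype k] [IsAlgClosure k K]

/-- Lang's trick: a rational point of `C_B` lifts to a geometric point `y` of `C'`, whose
conjugate is `b(y)` for some `b = σ(c) c⁻¹`, and then `c⁻¹(y)` is rational. -/
theorem IsUnramifiedAbelianCover.exists_comp_eq_of_isQuotientModel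
    (hf : IsUnramifiedAbelianCover K f)
    {g : C' ⟶ CB} {h : CB ⟶ C} (hg : IsQuotientModel f (frobeniusSubgroup K f hf.comm) g h)
    (Q : RationalPoint CB) : ∃ P : RationalPoint C', P ≫ f = Q ≫ h := by
  have : IsAlgClosed K := IsAlgClosure.isAlgClosed k
  have := hf.isCurve_source.isProper_extendScalars K
  have := hf.isCurve_target.isProper_extendScalars K
  have hfac : extendScalarsMap K g ≫ extendScalarsMap K h = extendScalarsMap K f := by
    rw [← extendScalarsMap_comp, hg.fac]
  have : IsFinite (extendScalarsMap K g ≫ extendScalarsMap K h).left := by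
    rw [hfac]
    exact extendScalarsMapLeft_of_isStableUnderBaseChange K @IsFinite hf.isFinite
  let σ := FiniteField.frobeniusAlgEquivOfAlgebraic k K
  obtain ⟨y, hy⟩ := hg.isGeometricQuotient.exists_comp_eq (extendScalarsMap K h)
    (geometricPoint K Q)
  obtain ⟨b, ⟨c, rfl⟩, hb⟩ := hg.comp_eq_comp_iff.mp (show y ≫ extendScalarsMap K g =
    galPoint σ y ≫ extendScalarsMap K g by
      rw [← galPoint_comp_map, hy, galPoint_geometricPoint])
  have hfix : galPoint σ (y ≫ (c⁻¹).1.hom) = y ≫ (c⁻¹).1.hom := by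
    rw [galPoint_comp_hom, ← hb]
    change (y ≫ _) ≫ (deckGal f σ c⁻¹).1.hom = _
    have hc : (deckGal f σ c⁻¹) * (deckGal f σ c * c⁻¹) = c⁻¹ := by
      rw [map_inv, inv_mul_cancel_left]
    exact (Category.assoc _ _ _).trans
      (congrArg (fun a : deckGroup K f => y ≫ a.1.hom) hc)
  obtain ⟨P, hP⟩ := exists_geometricPoint_eq
    (fun _ hc => FiniteField.mem_range_algebraMap_of_frobenius_eq hc) hfix
  refine ⟨P, geometricPoint_injective (K := K) ?_⟩
  rw [geometricPoint_comp, geometricPoint_comp, hP, deckGroup.comp_hom_comp_map, ← hfac, ← hy,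
    Category.assoc]

/-- The fibre of `C'(k)` over `f(P₀)` is the orbit of `P₀` under `A(k)`. -/
theorem IsUnramifiedAbelianCover.image_geometricPoint_fiber
    (hf : IsUnramifiedAbelianCover K f) (P₀ : RationalPoint C') :
    geometricPoint K '' {P | P ≫ f = P₀ ≫ f} =
      (fun a : deckGroup K f => geometricPoint K P₀ ≫ a.1.hom) '' rationalDeck K f := by
  apply Set.Subset.antisymm
  · rintro _ ⟨P, hP, rfl⟩
    obtain ⟨a, ha⟩ := hf.exists_comp_hom_eq (show geometricPoint K P₀ ≫ extendScalarsMap K f =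
      geometricPoint K P ≫ extendScalarsMap K f by
        rw [← geometricPoint_comp, ← geometricPoint_comp, hP])
    refine ⟨a, fun τ => hf.comp_hom_injective (geometricPoint K P₀) ?_, ha⟩
    refine (galPoint_geometricPoint_comp_hom τ P₀ a).symm.trans ?_
    rw [ha, galPoint_geometricPoint]
    exact ha.symm
  · rintro _ ⟨a, ha, rfl⟩
    obtain ⟨P, hP⟩ := exists_geometricPoint_eq
      (fun _ hc => FiniteField.mem_range_algebraMap_of_frobenius_eq (k := k) hc)
      (y := geometricPoint K P₀ ≫ a.1.hom) (by rw [galPoint_geometricPoint_comp_hom, ha])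
    refine ⟨P, geometricPoint_injective (K := K) ?_, hP⟩
    rw [geometricPoint_comp, geometricPoint_comp, hP, deckGroup.comp_hom_comp_map]

theorem IsUnramifiedAbelianCover.ncard_fiber
    (hf : IsUnramifiedAbelianCover K f) (P₀ : RationalPoint C') :
    {P : RationalPoint C' | P ≫ f = P₀ ≫ f}.ncard = (rationalDeck K f).ncard := by
  rw [← Set.ncard_image_of_injective _ (geometricPoint_injective (K := K)),
    hf.image_geometricPoint_fiber, Set.ncard_image_of_injective _ (hf.comp_hom_injective _)]

/-- The fibre of `C_B(k)` over `f(P₀)` is the image of the orbit of `P₀` under `A`: the images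
in `C_B` of the translates of `P₀` are rational, because `σ(a) ∈ B a`. -/
theorem IsUnramifiedAbelianCover.image_geometricPoint_fiber_of_isQuotientModel
    (hf : IsUnramifiedAbelianCover K f)
    {g : C' ⟶ CB} {h : CB ⟶ C} (hg : IsQuotientModel f (frobeniusSubgroup K f hf.comm) g h)
    (P₀ : RationalPoint C') :
    geometricPoint K '' {Q | Q ≫ h = P₀ ≫ f} = Set.range fun a : deckGroup K f =>
      (geometricPoint K P₀ ≫ a.1.hom) ≫ extendScalarsMap K g := by
  have : IsAlgClosed K := IsAlgClosure.isAlgClosed k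
  have := hf.isCurve_source.isProper_extendScalars K
  have := hf.isCurve_target.isProper_extendScalars K
  have hfac : extendScalarsMap K g ≫ extendScalarsMap K h = extendScalarsMap K f := by
    rw [← extendScalarsMap_comp, hg.fac]
  have : IsFinite (extendScalarsMap K g ≫ extendScalarsMap K h).left := by
    rw [hfac]
    exact extendScalarsMapLeft_of_isStableUnderBaseChange K @IsFinite hf.isFinite
  apply Set.Subset.antisymm
  · rintro _ ⟨Q, hQ, rfl⟩
    obtain ⟨y, hy⟩ := hg.isGeometricQuotient.exists_comp_eq (extendScalarsMap K h)
      (geometricPoint K Q)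
    obtain ⟨a, rfl⟩ := hf.exists_comp_hom_eq (show geometricPoint K P₀ ≫ extendScalarsMap K f =
      y ≫ extendScalarsMap K f by
        rw [← geometricPoint_comp, ← hQ, geometricPoint_comp, ← hy, Category.assoc, hfac])
    exact ⟨a, hy⟩
  · rintro _ ⟨a, rfl⟩
    obtain ⟨Q, hQ⟩ := exists_geometricPoint_eq
      (fun _ hc => FiniteField.mem_range_algebraMap_of_frobenius_eq (k := k) hc)
      (y := (geometricPoint K P₀ ≫ a.1.hom) ≫ extendScalarsMap K g) (by
        rw [galPoint_comp_map, galPoint_geometricPoint_comp_hom]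
        refine (hg.comp_eq_comp_iff.mpr ⟨_, ⟨a, rfl⟩, ?_⟩).symm
        exact (Category.assoc _ _ _).trans (congrArg
          (fun a : deckGroup K f => geometricPoint K P₀ ≫ a.1.hom) (inv_mul_cancel_right _ _)))
    refine ⟨Q, geometricPoint_injective (K := K) ?_, hQ⟩
    rw [geometricPoint_comp, geometricPoint_comp, hQ, Category.assoc, hfac,
      deckGroup.comp_hom_comp_map]

theorem IsUnramifiedAbelianCover.ncard_fiber_of_isQuotientModel
    (hf : IsUnramifiedAbelianCover K f)
    {g : C' ⟶ CB} {h : CB ⟶ C} (hg : IsQuotientModel f (frobeniusSubgroup K f hf.comm) g h)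
    (P₀ : RationalPoint C') :
    {Q : RationalPoint CB | Q ≫ h = P₀ ≫ f}.ncard = (frobeniusSubgroup K f hf.comm).index := by
  let F : deckGroup K f → RationalPoint (extendScalars K CB) := fun a =>
    (geometricPoint K P₀ ≫ a.1.hom) ≫ extendScalarsMap K g
  have hF (a b : deckGroup K f) : F a = F b ↔ a⁻¹ * b ∈ frobeniusSubgroup K f hf.comm := by
    refine hg.comp_eq_comp_iff.trans ⟨?_, fun hab => ⟨_, hab, ?_⟩⟩
    · rintro ⟨c, hc, hab⟩
      have : c * a = b := hf.comp_hom_injective (geometricPoint K P₀)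
        ((Category.assoc _ _ _).symm.trans hab)
      rwa [← this, hf.comm c a, inv_mul_cancel_left]
    · have : (a⁻¹ * b) * a = b := by rw [hf.comm _ a, mul_inv_cancel_left]
      exact (Category.assoc _ _ _).trans (congrArg
        (fun a : deckGroup K f => geometricPoint K P₀ ≫ a.1.hom) this)
  let F' : deckGroup K f ⧸ frobeniusSubgroup K f hf.comm → RationalPoint (extendScalars K CB) :=
    Quotient.lift F fun a b hab => (hF a b).mpr (QuotientGroup.leftRel_apply.mp hab)
  have hF' : Function.Injective F' := by
    rintro ⟨a⟩ ⟨b⟩ hab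
    exact QuotientGroup.eq.mpr ((hF a b).mp hab)
  have hrange : Set.range F' = Set.range F := Set.range_quot_lift _
  rw [← Set.ncard_image_of_injective _ (geometricPoint_injective (K := K)),
    hf.image_geometricPoint_fiber_of_isQuotientModel hg]
  change (Set.range F).ncard = _
  rw [← hrange, Set.ncard_range_of_injective hF']
  rfl

end Points

/-! ### Properties of affine coequalizers -/

namespace AffineCoequalizer

/-- This moves a statement about sections over `f⁻¹(U)` to sections over `g⁻¹(h⁻¹(U))`; the two open
sets are equal, but not by definition. -/
theorem app_injective_of_appLE_injective {X T Y : Scheme.{u}} (g : X ⟶ T) (h : T ⟶ Y) {f : X ⟶ Y}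
    (hfac : g ≫ h = f) (U : Y.Opens) (hle : f ⁻¹ᵁ U ≤ g ⁻¹ᵁ h ⁻¹ᵁ U)
    (hinj : Function.Injective (g.appLE (h ⁻¹ᵁ U) (f ⁻¹ᵁ U) hle)) :
    Function.Injective (g.app (h ⁻¹ᵁ U)) := by
  subst hfac
  rw [Scheme.Hom.app_eq_appLE]
  exact hinj

theorem exists_app_eq_of_exists_appLE_eq {X T Y Z : Scheme.{u}} (g : X ⟶ T) (h : T ⟶ Y)
    {f : X ⟶ Y} (hfac : g ≫ h = f) {I : Type u} (a b : I → (Z ⟶ X)) (w : Z ⟶ Y)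
    (ha : ∀ i, a i ≫ f = w) (hb : ∀ i, b i ≫ f = w) (U : Y.Opens)
    (hle : f ⁻¹ᵁ U ≤ g ⁻¹ᵁ h ⁻¹ᵁ U)
    (hex : ∀ s ∈ sections f a b w ha hb U, ∃ t, g.appLE (h ⁻¹ᵁ U) (f ⁻¹ᵁ U) hle t = s)
    {s : Γ(X, g ⁻¹ᵁ h ⁻¹ᵁ U)}
    (hs : ∀ i (h₁ : w ⁻¹ᵁ U ≤ a i ⁻¹ᵁ g ⁻¹ᵁ h ⁻¹ᵁ U) (h₂ : w ⁻¹ᵁ U ≤ b i ⁻¹ᵁ g ⁻¹ᵁ h ⁻¹ᵁ U),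
      (a i).appLE _ _ h₁ s = (b i).appLE _ _ h₂ s) :
    ∃ t, g.app (h ⁻¹ᵁ U) t = s := by
  subst hfac
  rw [Scheme.Hom.app_eq_appLE]
  exact hex s (mem_familyEqLocus.mpr fun i => hs i _ _)

/-- The affine coequalizer `Q` of a finite family of pairs `aᵢ, bᵢ : Z ⟶ X` over `Y`: over affine open
subsets of `Y`, its sections are the sections of `X` on which all pairs agree. -/
theorem exists_factorization {X Y Z : Scheme.{u}} (f : X ⟶ Y) {I : Type u}
    (a b : I → (Z ⟶ X)) (w : Z ⟶ Y) (ha : ∀ i, a i ≫ f = w) (hb : ∀ i, b i ≫ f = w)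
    [Finite I] [IsAffineHom f] [QuasiCompact w] [QuasiSeparated w] :
    ∃ (Q : Scheme.{u}) (g : X ⟶ Q) (h : Q ⟶ Y), g ≫ h = f ∧ IsAffineHom h ∧
      (∀ i, a i ≫ g = b i ≫ g) ∧
      (∀ U : Y.Opens, IsAffineOpen U → Function.Injective (g.app (h ⁻¹ᵁ U))) ∧
      ∀ U : Y.Opens, IsAffineOpen U → ∀ s : Γ(X, g ⁻¹ᵁ h ⁻¹ᵁ U),
        (∀ i (h₁ : w ⁻¹ᵁ U ≤ a i ⁻¹ᵁ g ⁻¹ᵁ h ⁻¹ᵁ U) (h₂ : w ⁻¹ᵁ U ≤ b i ⁻¹ᵁ g ⁻¹ᵁ h ⁻¹ᵁ U),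
          (a i).appLE _ _ h₁ s = (b i).appLE _ _ h₂ s) → ∃ t, g.app (h ⁻¹ᵁ U) t = s := by
  have hfac := π_toBase f a b w ha hb
  refine ⟨obj f a b w ha hb, π f a b w ha hb, toBase f a b w ha hb, hfac, inferInstance,
    comp_π_eq f a b w ha hb, fun U hU => ?_, fun U hU s hs => ?_⟩
  · exact app_injective_of_appLE_injective _ _ hfac U _ (π_appLE_injective f a b w ha hb hU)
  · exact exists_app_eq_of_exists_appLE_eq _ _ hfac a b w ha hb U _
      (fun s hs => exists_π_appLE_eq f a b w ha hb hU hs) hs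

end AffineCoequalizer

section Factorization

variable {X T Y : Scheme.{u}} (g : X ⟶ T) (h : T ⟶ Y)

/-- The kernel ideal of `g` vanishes on the affine cover by the open sets `h⁻¹(U)`. -/
theorem isSchemeTheoreticallyDominant_of_app_injective [QuasiCompact g] [IsAffineHom h]
    (hinj : ∀ U : Y.Opens, IsAffineOpen U → Function.Injective (g.app (h ⁻¹ᵁ U))) :
    IsSchemeTheoreticallyDominant g := by
  rw [isSchemeTheoreticallyDominant_iff]
  refine Scheme.IdealSheafData.ext_of_iSup_eq_top
    (fun U : Y.affineOpens => ⟨h ⁻¹ᵁ U.1, U.2.preimage h⟩) ?_ fun U => ?_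
  · change ⨆ U : Y.affineOpens, h ⁻¹ᵁ U.1 = ⊤
    rw [← Scheme.Hom.preimage_iSup, iSup_affineOpens_eq_top]
    rfl
  · rw [Scheme.Hom.ker_apply, RingHom.injective_iff_ker_eq_bot _ |>.mp (hinj U.1 U.2)]
    rfl

/-- A submodule of a finite module over a noetherian ring is finite. -/
theorem isFinite_of_app_injective [IsAffineHom h] [IsFinite (g ≫ h)] [IsLocallyNoetherian Y]
    (hinj : ∀ U : Y.Opens, IsAffineOpen U → Function.Injective (g.app (h ⁻¹ᵁ U))) :
    IsFinite h := by
  refine ⟨fun U hU => ?_⟩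
  have hfin : ((g.app (h ⁻¹ᵁ U)).hom.comp (h.app U).hom).Finite :=
    (IsFinite.finite_app (g ≫ h)) U hU
  have hU' := hinj U hU
  have : IsNoetherianRing Γ(Y, U) := IsLocallyNoetherian.component_noetherian ⟨U, hU⟩
  change Function.Injective (g.app (h ⁻¹ᵁ U)).hom at hU'
  generalize (h.app U).hom = φ at *
  generalize (g.app (h ⁻¹ᵁ U)).hom = ψ at *
  algebraize [φ, ψ, ψ.comp φ]
  change Module.Finite Γ(Y, U) Γ(T, h ⁻¹ᵁ U)
  exact Module.Finite.of_injective
    (IsScalarTower.toAlgHom Γ(Y, U) Γ(T, h ⁻¹ᵁ U) Γ(X, g ⁻¹ᵁ h ⁻¹ᵁ U)).toLinearMap hU'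

theorem surjective_of_isFinite_of_isDominant [IsFinite g] [IsDominant g] : Surjective g := by
  have := g.isClosedMap.isClosed_range.closure_eq
  rw [g.denseRange.closure_range] at this
  exact ⟨Set.range_eq_univ.mp this.symm⟩

/-- Geometric integrality descends along surjective schematically dominant morphisms. -/
theorem geometricallyIntegral_of_comp {k : Type u} [Field k] (s : T ⟶ Spec (.of k))
    [IsSchemeTheoreticallyDominant g] [QuasiCompact g] [Surjective g]
    [GeometricallyIntegral (g ≫ s)] : GeometricallyIntegral s := by
  refine ⟨fun F _ y Z fst snd hZ => ?_⟩
  have hX := IsPullback.paste_horiz (IsPullback.of_hasPullback g fst).flip hZ.flip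
  have : IsIntegral (pullback g fst) :=
    GeometricallyIntegral.geometrically_isIntegral (f := g ≫ s) y _ _ hX.flip
  have : Flat y := inferInstance
  have : Flat fst := MorphismProperty.of_isPullback (P := @Flat) hZ.flip ‹_›
  let g' : pullback g fst ⟶ Z := pullback.snd g fst
  have : IsReduced Z := IsSchemeTheoreticallyDominant.isReduced g'
  have : IrreducibleSpace Z := by
    have h := (IrreducibleSpace.isIrreducible_univ (pullback g fst : Scheme)).image g'
      g'.continuous.continuousOn
    rw [Set.image_univ, g'.surjective.range_eq] at h
    exact (irreducibleSpace_def _).mpr h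
  exact isIntegral_of_irreducibleSpace_of_isReduced Z

end Factorization

/-! ### Galois descent of invariant sections -/

section Descent

theorem appLE_congr_hom {X Y : Scheme.{u}} {f g : X ⟶ Y} (h : f = g) {U : Y.Opens} {V : X.Opens}
    (hf : V ≤ f ⁻¹ᵁ U) (hg : V ≤ g ⁻¹ᵁ U) : f.appLE U V hf = g.appLE U V hg := by
  subst h
  rfl

/-- If `a ≫ c = c ≫ b`, then `c` pulls back sections fixed by `b` to sections fixed by `a`. -/
theorem appLE_appLE_eq_of_comp_eq {X : Scheme.{u}} {a b c : X ⟶ X} (h : a ≫ c = c ≫ b)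
    {U : X.Opens} (ha : U ≤ a ⁻¹ᵁ U) (hb : U ≤ b ⁻¹ᵁ U) (hc : U ≤ c ⁻¹ᵁ U) {x : Γ(X, U)}
    (hx : b.appLE U U hb x = x) : a.appLE U U ha (c.appLE U U hc x) = c.appLE U U hc x := by
  have h1 := Scheme.Hom.appLE_comp_appLE a c U U U hc ha
  have h2 := Scheme.Hom.appLE_comp_appLE c b U U U hb hc
  have h3 := h1.trans ((appLE_congr_hom h _ _).trans h2.symm)
  exact congr($h3 x).trans (congrArg (c.appLE U U hc) hx)

/-- The structure map `K ⟶ Γ(X, U)` of the `K`-algebra of sections over `U`, for a scheme `X` over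
the field `K`. -/
noncomputable def sectionsStructure {K : Type u} [Field K] {X : Scheme.{u}}
    (s : X ⟶ Spec (.of K)) (U : X.Opens) : CommRingCat.of K ⟶ Γ(X, U) :=
  (Scheme.ΓSpecIso (.of K)).inv ≫ s.appLE ⊤ U le_top

theorem sectionsStructure_comp_appLE {K : Type u} [Field K] {X Y : Scheme.{u}}
    (s : Y ⟶ Spec (.of K)) (t : X ⟶ Spec (.of K)) (g : X ⟶ Y) (hg : g ≫ s = t) (U : Y.Opens)
    (V : X.Opens) (h : V ≤ g ⁻¹ᵁ U) :
    sectionsStructure s U ≫ g.appLE U V h = sectionsStructure t V := by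
  subst hg
  exact (Category.assoc _ _ _).trans
    (congrArg _ (Scheme.Hom.appLE_comp_appLE g s ⊤ U V le_top h))

theorem sectionsStructure_comp_specMap {K L : Type u} [Field K] [Field L] {X : Scheme.{u}}
    (s : X ⟶ Spec (.of K)) (φ : CommRingCat.of L ⟶ CommRingCat.of K) (U : X.Opens) :
    sectionsStructure (s ≫ Spec.map φ) U = φ ≫ sectionsStructure s U := by
  have h : (Spec.map φ).appLE ⊤ ⊤ le_top = (Spec.map φ).appTop := by
    simp [Scheme.Hom.app_eq_appLE]
  have h' := Scheme.Hom.appLE_comp_appLE s (Spec.map φ) ⊤ ⊤ U le_top le_top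
  rw [h] at h'
  refine (congrArg _ h'.symm).trans ?_
  exact (Scheme.ΓSpecIso_inv_naturality_assoc φ _).symm

variable {k : Type u} [Field k] {K : Type u} [Field K] [Algebra k K]

/-- Galois descent for a base change `B = A ⊗ₖ K`: a `K`-subspace of `B` that is stable under the
semilinear automorphism `Φ` is contained in every subring that contains `K` and the elements of
the subspace that come from `A`. -/
theorem mem_of_semilinear_stable_of_isPushout {A B : CommRingCat.{u}} {i : .of k ⟶ A} {ι : A ⟶ B}
    {c : .of K ⟶ B} (H : IsPushout i (CommRingCat.ofHom (algebraMap k K)) ι c) {σ : K →+* K}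
    (hσ : ∀ x, σ x = x → x ∈ Set.range (algebraMap k K)) (Φ : B ⟶ B) (hΦι : ι ≫ Φ = ι)
    (hΦc : c ≫ Φ = CommRingCat.ofHom σ ≫ c) (W : AddSubgroup B)
    (hWc : ∀ (l : K), ∀ x ∈ W, c l * x ∈ W) (hWΦ : ∀ x ∈ W, Φ x ∈ W) (T : Subring B)
    (hTc : ∀ l : K, c l ∈ T) (hT : ∀ v : A, ι v ∈ W → ι v ∈ T) {x : B} (hx : x ∈ W) : x ∈ T := by
  let _ : Algebra k A := i.hom.toAlgebra
  let _ : Algebra A B := ι.hom.toAlgebra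
  let _ : Algebra K B := c.hom.toAlgebra
  let _ : Algebra k B := (c.hom.comp (algebraMap k K)).toAlgebra
  have : IsScalarTower k K B := .of_algebraMap_eq fun _ => rfl
  have : IsScalarTower k A B := .of_algebraMap_eq fun a => (congr($(H.w) a)).symm
  have : Algebra.IsPushout k K A B := CommRingCat.isPushout_iff_isPushout.mp H.flip
  let W' : Submodule K B :=
    { W with smul_mem' := fun l x hx => hWc l x hx }
  have h := mem_span_of_semilinear_stable (k := k) (K := K)
    (ι := (IsScalarTower.toAlgHom k A B).toLinearMap)
    (Algebra.IsPushout.out (R := k) (S := K) (R' := A) (S' := B)) hσ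
    Φ.hom.toAddMonoidHom (fun v => congr($hΦι v)) (fun l x => by
      change Φ (c l * x) = c (σ l) * Φ x
      rw [map_mul]
      exact congrArg (· * Φ x) congr($hΦc l)) W' hWΦ hx
  refine Submodule.span_induction ?_ T.zero_mem (fun _ _ _ _ => T.add_mem) (fun l y _ hy =>
    T.mul_mem (hTc l) hy) h
  rintro _ ⟨hy, v, rfl⟩
  exact hT v hy

/-- Over an affine open set `U`, the sections of the base change `X_K` are `Γ(X, U) ⊗ₖ K`. -/
theorem isPushout_sections_extendScalars (X : SchemeOver k) {U : X.left.Opens}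
    (hU : IsAffineOpen U) {O : (extendScalars K X).left.Opens}
    (hO : O = pullback.fst X.hom (specExt k K) ⁻¹ᵁ U) :
    IsPushout (sectionsStructure X.hom U)
      (CommRingCat.ofHom (algebraMap k K))
      ((pullback.fst X.hom (specExt k K)).appLE U O hO.le)
      (sectionsStructure (pullback.snd X.hom (specExt k K)) O) := by
  have H := (isIso_pushoutSection_iff (IsPullback.of_hasPullback X.hom (specExt k K))
    (US := ⊤) (UT := ⊤) (UX := U) (UY := O) le_top le_top (by simp [hO])).mp
    (isIso_pushoutSection_of_isAffineOpen _ _ _ _ (isAffineOpen_top _) (isAffineOpen_top _) hU)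
  refine H.of_iso (Scheme.ΓSpecIso _) (Iso.refl _) (Scheme.ΓSpecIso _) (Iso.refl _) ?_ ?_ ?_ ?_
  · simp [sectionsStructure]
  · have : (specExt k K).appLE ⊤ ⊤ le_top = (specExt k K).appTop := by
      simp [Scheme.Hom.app_eq_appLE]
    rw [this]
    exact Scheme.ΓSpecIso_naturality _
  · exact (Category.comp_id _).trans (Category.id_comp _).symm
  · refine (Category.comp_id _).trans ?_
    exact (Iso.hom_inv_id_assoc (Scheme.ΓSpecIso (.of K)) _).symm

variable {X T : SchemeOver k}

/-- Semilinear maps permute the automorphisms of `X_K` by conjugation; therefore they preserve the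
sections that are invariant under a Galois stable group. -/
theorem hom_left_comp_semilinear (X : SchemeOver k) (σ : K ≃ₐ[k] K)
    (a : Aut (extendScalars K X)) :
    a.hom.left ≫ semilinear X σ = semilinear X σ ≫ (galConj X σ⁻¹ a).hom.left := by
  change _ = semilinear X σ ≫ semilinear X σ⁻¹ ≫ a.hom.left ≫ semilinear X σ⁻¹⁻¹
  rw [inv_inv, ← Category.assoc, semilinear_comp_inv]
  exact (Category.id_comp _).symm

/-- Galois descent for invariant sections: if the sections of `X` over `g⁻¹(U)` that are invariant
under `G` over `K` come from `T`, then so do all `G`-invariant sections of `X_K`. -/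
theorem exists_appLE_eq_of_invariant {σ : K ≃ₐ[k] K}
    (hσ : ∀ x, σ x = x → x ∈ Set.range (algebraMap k K)) (g : X ⟶ T) [IsAffineHom g.left]
    {G : Set (Aut (extendScalars K X))} (hG : ∀ a ∈ G, galConj X σ⁻¹ a ∈ G)
    {U : T.left.Opens} (hU : IsAffineOpen U) {V : (extendScalars K T).left.Opens}
    (hV : V = pullback.fst T.hom (specExt k K) ⁻¹ᵁ U) {O : (extendScalars K X).left.Opens}
    (hO : O = pullback.fst X.hom (specExt k K) ⁻¹ᵁ g.left ⁻¹ᵁ U)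
    (hO' : O ≤ (extendScalarsMap K g).left ⁻¹ᵁ V)
    (hle : ∀ a ∈ G, O ≤ a.hom.left ⁻¹ᵁ O)
    (hex : ∀ v : Γ(X.left, g.left ⁻¹ᵁ U),
      (∀ a ∈ G, ∀ h₁ h₂,
        (a.hom.left ≫ pullback.fst X.hom (specExt k K)).appLE (g.left ⁻¹ᵁ U) O h₁ v =
          (pullback.fst X.hom (specExt k K)).appLE (g.left ⁻¹ᵁ U) O h₂ v) →
      ∃ t, g.left.app U t = v)
    (s : Γ((extendScalars K X).left, O))
    (hs : ∀ (a : Aut _) (ha : a ∈ G), a.hom.left.appLE O O (hle a ha) s = s) :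
    ∃ t, (extendScalarsMap K g).left.appLE V O hO' t = s := by
  have hslO : O ≤ semilinear X σ ⁻¹ᵁ O := by
    rw [hO]
    exact AffineCoequalizer.preimage_le_preimage (semilinear_fst X σ) (g.left ⁻¹ᵁ U)
  have H := isPushout_sections_extendScalars (K := K) X (hU.preimage g.left) hO
  let Φ := (semilinear X σ).appLE O O hslO
  let W : AddSubgroup Γ((extendScalars K X).left, O) :=
    { carrier := {s | ∀ (a : Aut _) (ha : a ∈ G), a.hom.left.appLE O O (hle a ha) s = s}
      zero_mem' := fun _ _ => map_zero _
      add_mem' := fun {x y} hx hy a ha => by rw [map_add, hx a ha, hy a ha]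
      neg_mem' := fun {x} hx a ha => by rw [map_neg, hx a ha] }
  refine mem_of_semilinear_stable_of_isPushout H (σ := (σ : K →+* K)) hσ Φ ?_ ?_ W ?_ ?_
    ((extendScalarsMap K g).left.appLE V O hO').hom.range ?_ ?_ hs
  · exact (Scheme.Hom.appLE_comp_appLE _ _ _ _ _ _ _).trans
      (appLE_congr_hom (semilinear_fst X σ) _ _)
  · exact (sectionsStructure_comp_appLE _ _ _ (semilinear_snd X σ) _ _ _).trans
      (sectionsStructure_comp_specMap _ _ _)
  · intro l x hx a ha
    have h := sectionsStructure_comp_appLE _ _ a.hom.left (Over.w a.hom) O O (hle a ha)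
    rw [map_mul, hx a ha]
    exact congrArg (· * x) congr($h l)
  · intro x hx a ha
    exact appLE_appLE_eq_of_comp_eq (hom_left_comp_semilinear X σ a) (hle a ha)
      (hle _ (hG a ha)) hslO (hx _ (hG a ha))
  · intro l
    have h := sectionsStructure_comp_appLE _ _ (extendScalarsMap K g).left
      (extendScalarsMapLeft_snd K g) V O hO'
    exact ⟨sectionsStructure (extendScalars K T).hom V l, congr($h l)⟩
  · intro v hv
    obtain ⟨t, rfl⟩ := hex v (by
      intro a ha h₁ h₂
      have h := Scheme.Hom.appLE_comp_appLE a.hom.left (pullback.fst X.hom (specExt k K))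
        (g.left ⁻¹ᵁ U) O O hO.le (hle a ha)
      exact congr($h v).symm.trans (hv a ha))
    have h1 := Scheme.Hom.appLE_comp_appLE (extendScalarsMap K g).left
      (pullback.fst T.hom (specExt k K)) U V O hV.le hO'
    have h2 := Scheme.Hom.appLE_comp_appLE (pullback.fst X.hom (specExt k K)) g.left U
      (g.left ⁻¹ᵁ U) O le_rfl hO.le
    have h3 := h1.trans ((appLE_congr_hom (extendScalarsMapLeft_fst K g) _ _).trans h2.symm)
    rw [Scheme.Hom.app_eq_appLE]
    exact ⟨_, congr($h3 t)⟩

end Descent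

/-! ### Quotients by finite groups and base change -/

section GeometricQuotient

/-- For a finite, schematically dominant map, being the quotient by a finite group can be checked on
sections over an affine cover of the target. -/
theorem isGeometricQuotient_of_cover {S : Scheme.{u}} {X Y : Over S} {G : Subgroup (Aut X)}
    [Finite G] {π : X ⟶ Y} [IsFinite π.left] [IsSchemeTheoreticallyDominant π.left]
    (hinv : ∀ a ∈ G, a.hom ≫ π = π)
    (hex : ∀ y : Y.left, ∃ U, IsAffineOpen U ∧ y ∈ U ∧ ∀ s : Γ(X.left, π.left ⁻¹ᵁ U),
      (∀ (a : Aut X) (ha : a ∈ G), a.hom.left.appLE (π.left ⁻¹ᵁ U) (π.left ⁻¹ᵁ U)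
        (preimage_le_of_comp_eq (hinv a ha) U) s = s) → ∃ t, π.left.app U t = s) :
    IsGeometricQuotient G π where
  invariant := hinv
  isQuotientMap := by
    have := surjective_of_isFinite_of_isDominant π.left
    exact π.left.isClosedMap.isQuotientMap π.left.continuous π.left.surjective
  orbit x y hxy := by
    obtain ⟨U, hU, hx, h⟩ := hex (π.left x)
    exact exists_apply_eq_of_exists_app_eq hinv hU h hx hxy
  app_injective := π.left.app_injective
  exists_app_eq U s hs := by
    have hid (V : Y.left.Opens) (hle : π.left ⁻¹ᵁ V ≤ (𝟙 X.left) ⁻¹ᵁ π.left ⁻¹ᵁ V)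
        (s : Γ(X.left, π.left ⁻¹ᵁ V)) :
        (𝟙 X.left : X.left ⟶ X.left).appLE (π.left ⁻¹ᵁ V) (π.left ⁻¹ᵁ V) hle s = s := by
      exact congr($(Category.id_comp (X.left.presheaf.map (homOfLE hle).op)) s).trans
        congr($(X.left.presheaf.map_id _) s)
    refine AffineCoequalizer.exists_app_eq_of_cover π.left (fun a : G => a.1.hom.left)
      (fun _ => 𝟙 _) π.left (fun a => congrArg CommaMorphism.left (hinv _ a.2))
      (fun _ => Category.id_comp _) π.left.app_injective (fun y => ?_) U
      (mem_familyEqLocus.mpr fun a => (hs a.1 a.2).trans (hid _ _ _).symm)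
    obtain ⟨V, hV, hy, h⟩ := hex y
    exact ⟨V, hV, hy, fun s hs => h s fun a ha =>
      (mem_familyEqLocus.mp hs ⟨a, ha⟩).trans (hid _ _ _)⟩

variable {k : Type u} [Field k] {K : Type u} [Field K] [Algebra k K] {X T : SchemeOver k}

/-- If the sections of `T` are the sections of `X` that are invariant over `K` under a Galois stable
finite group `G`, then `T_K` is the quotient of `X_K` by `G`. The open set `O` is a variable in the
hypothesis because `p⁻¹(g⁻¹(U))` may be given as the preimage under a composite. -/
theorem isGeometricQuotient_extendScalarsMap {σ : K ≃ₐ[k] K}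
    (hσ : ∀ x, σ x = x → x ∈ Set.range (algebraMap k K)) (g : X ⟶ T) [IsFinite g.left]
    [IsSchemeTheoreticallyDominant g.left]
    {G : Subgroup (Aut (extendScalars K X))} [Finite G] (hG : ∀ a ∈ G, galConj X σ⁻¹ a ∈ G)
    (hinv : ∀ a ∈ G, a.hom ≫ extendScalarsMap K g = extendScalarsMap K g)
    (hex : ∀ y : T.left, ∃ U, IsAffineOpen U ∧ y ∈ U ∧ ∀ v : Γ(X.left, g.left ⁻¹ᵁ U),
      (∀ a ∈ G, ∀ O, O = pullback.fst X.hom (specExt k K) ⁻¹ᵁ g.left ⁻¹ᵁ U → ∀ h₁ h₂,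
        (a.hom.left ≫ pullback.fst X.hom (specExt k K)).appLE (g.left ⁻¹ᵁ U) O h₁ v =
          (pullback.fst X.hom (specExt k K)).appLE (g.left ⁻¹ᵁ U) O h₂ v) →
      ∃ t, g.left.app U t = v) :
    IsGeometricQuotient G (extendScalarsMap K g) := by
  have : IsFinite (extendScalarsMap K g).left :=
    extendScalarsMapLeft_of_isStableUnderBaseChange K @IsFinite ‹_›
  have : IsSchemeTheoreticallyDominant (extendScalarsMap K g).left :=
    IsSchemeTheoreticallyDominant.of_isPullback (isPullback_extendScalarsMapLeft K g)
  refine isGeometricQuotient_of_cover hinv fun y => ?_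
  obtain ⟨U, hU, hy, h⟩ := hex (pullback.fst T.hom (specExt k K) y)
  have hO : (extendScalarsMap K g).left ⁻¹ᵁ pullback.fst T.hom (specExt k K) ⁻¹ᵁ U =
      pullback.fst X.hom (specExt k K) ⁻¹ᵁ g.left ⁻¹ᵁ U :=
    congrArg (· ⁻¹ᵁ U) (extendScalarsMapLeft_fst K g)
  have : IsAffineHom (pullback.fst T.hom (specExt k K)) :=
    isAffineHom_isStableUnderBaseChange.of_isPullback
      (IsPullback.of_hasPullback T.hom (specExt k K)).flip (inferInstanceAs (IsAffineHom (specExt k K)))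
  refine ⟨pullback.fst T.hom (specExt k K) ⁻¹ᵁ U, hU.preimage _, hy, fun s hs => ?_⟩
  obtain ⟨t, ht⟩ := exists_appLE_eq_of_invariant hσ g (G := (G : Set _)) hG hU rfl hO le_rfl
    (fun a ha => preimage_le_of_comp_eq (hinv a ha) _) (fun v hv => h v fun a ha O hO' h₁ h₂ => by
      obtain rfl := hO'.trans hO.symm
      exact hv a ha h₁ h₂) s hs
  refine ⟨t, ?_⟩
  rw [Scheme.Hom.app_eq_appLE]
  exact ht

end GeometricQuotient

/-! ### The intermediate curve -/

section Existence

variable {k : Type u} [Field k] {K : Type u} [Field K] [Algebra k K]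

/-- A finite unramified morphism that becomes the quotient by a free action of a finite group over
an extension field is étale: over the extension field it is flat and unramified. -/
theorem etale_left_of_isGeometricQuotient {X T : SchemeOver k} (g : X ⟶ T) [IsFinite g.left]
    [LocallyOfFinitePresentation g.left] [FormallyUnramified g.left]
    {G : Subgroup (Aut (extendScalars K X))} [Finite G]
    (hg : IsGeometricQuotient G (extendScalarsMap K g))
    (hfree : ∀ a ∈ G, ∀ (F : Type u) [Field F] (x : Spec (.of F) ⟶ (extendScalars K X).left),
      x ≫ a.hom.left = x → a = 1) : Etale g.left := by
  have : IsFinite (extendScalarsMap K g).left :=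
    extendScalarsMapLeft_of_isStableUnderBaseChange K @IsFinite ‹_›
  have : LocallyOfFinitePresentation (extendScalarsMap K g).left :=
    extendScalarsMapLeft_of_isStableUnderBaseChange K @LocallyOfFinitePresentation ‹_›
  have : FormallyUnramified (extendScalarsMap K g).left :=
    extendScalarsMapLeft_of_isStableUnderBaseChange K @FormallyUnramified ‹_›
  have := hg.flat hfree
  have : Etale (extendScalarsMap K g).left := Etale.of_formallyUnramified_of_flat _
  have hT := (IsPullback.of_hasPullback T.hom (specExt k K)).flip
  refine MorphismProperty.of_isPullback_of_descendsAlong (P := @Etale)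
    (Q := @Surjective ⊓ @Flat ⊓ @QuasiCompact) (isPullback_extendScalarsMapLeft K g).flip
    ⟨⟨?_, ?_⟩, ?_⟩ this
  · exact MorphismProperty.of_isPullback (P := @Surjective) hT (inferInstanceAs
      (Surjective (specExt k K)))
  · exact MorphismProperty.of_isPullback (P := @Flat) hT (inferInstanceAs (Flat (specExt k K)))
  · exact MorphismProperty.of_isPullback (P := @QuasiCompact) hT (inferInstanceAs
      (QuasiCompact (specExt k K)))

variable {C' C CB : SchemeOver k} {f : C' ⟶ C}

/-- An intermediate cover of an unramified abelian cover is a smooth projective curve. -/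
theorem IsUnramifiedAbelianCover.isSmoothProjectiveCurve_of_isQuotientModel [IsAlgClosed K]
    (hf : IsUnramifiedAbelianCover K f) {B : Subgroup (deckGroup K f)} {g : C' ⟶ CB} {h : CB ⟶ C}
    (hg : IsQuotientModel f B g h) [IsFinite h.left] [IsSchemeTheoreticallyDominant g.left] :
    IsSmoothProjectiveCurve CB := by
  have := hf.finite_deckGroup
  have hfac : g.left ≫ h.left = f.left := congrArg CommaMorphism.left hg.fac
  have := hf.isFinite
  have := hf.unramified
  have := hf.isCurve_target.proper
  have := hf.isCurve_target.smooth
  have := hf.isCurve_source.geometricallyIntegral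
  have : IsLocallyNoetherian C.left := LocallyOfFiniteType.isLocallyNoetherian C.hom
  have : IsLocallyNoetherian CB.left := LocallyOfFiniteType.isLocallyNoetherian h.left
  have : IsFinite (g.left ≫ h.left) := by rwa [hfac]
  have : IsFinite g.left := IsFinite.of_comp g.left h.left
  have : FormallyUnramified (g.left ≫ h.left) := by rwa [hfac]
  have : FormallyUnramified g.left := FormallyUnramified.of_comp g.left h.left
  have : LocallyOfFinitePresentation f.left :=
    LocallyOfFinitePresentation.iff_locallyOfFiniteType.mpr inferInstance
  have : LocallyOfFinitePresentation g.left :=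
    LocallyOfFinitePresentation.iff_locallyOfFiniteType.mpr inferInstance
  have : LocallyOfFinitePresentation h.left :=
    LocallyOfFinitePresentation.iff_locallyOfFiniteType.mpr inferInstance
  have : Etale f.left := etale_left_of_isGeometricQuotient f hf.isGeometricQuotient
    fun a ha F _ x hx => hf.eq_one_of_comp_eq ha x hx
  have : Finite (B.map (deckGroup K f).subtype) := Finite.Set.finite_image _ _
  have : Etale g.left := etale_left_of_isGeometricQuotient g hg.isGeometricQuotient
    fun a ha F _ x hx => by
      obtain ⟨b, -, rfl⟩ := ha
      exact hf.eq_one_of_comp_eq b.2 x hx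
  have : Surjective g.left := surjective_of_isFinite_of_isDominant g.left
  have : Etale (g.left ≫ h.left) := by rwa [hfac]
  have : Etale h.left := etale_of_etale_comp g.left h.left
  have hw : h.left ≫ C.hom = CB.hom := Over.w h
  have hw' : g.left ≫ CB.hom = C'.hom := Over.w g
  have : GeometricallyIntegral (g.left ≫ CB.hom) := by rwa [hw']
  refine ⟨?_, ?_, geometricallyIntegral_of_comp g.left CB.hom⟩
  · rw [← hw]
    exact smoothOfRelativeDimension_comp 0 1 h.left C.hom
  · rw [← hw]
    infer_instance

/-- The quotient of the cover by a Galois stable subgroup `B` has a model over `k`: locally on `C`,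
its coordinate ring consists of the functions on `C'` that are invariant under `B` over `K`. -/
theorem IsUnramifiedAbelianCover.exists_isQuotientModel [IsAlgClosed K]
    (hf : IsUnramifiedAbelianCover K f) {σ : K ≃ₐ[k] K}
    (hσ : ∀ x, σ x = x → x ∈ Set.range (algebraMap k K)) {B : Subgroup (deckGroup K f)}
    (hB : ∀ b ∈ B, deckGal f σ⁻¹ b ∈ B) :
    ∃ (CB : SchemeOver k) (g : C' ⟶ CB) (h : CB ⟶ C),
      IsSmoothProjectiveCurve CB ∧ IsQuotientModel f B g h := by
  have := hf.finite_deckGroup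
  have := hf.isFinite
  have := hf.isCurve_target.proper
  have : IsLocallyNoetherian C.left := LocallyOfFiniteType.isLocallyNoetherian C.hom
  have : IsAffineHom (pullback.fst C'.hom (specExt k K)) :=
    isAffineHom_isStableUnderBaseChange.of_isPullback
      (IsPullback.of_hasPullback C'.hom (specExt k K)).flip
      (inferInstanceAs (IsAffineHom (specExt k K)))
  have hcomp (b : B) : (b.1.1.hom.left ≫ pullback.fst C'.hom (specExt k K)) ≫ f.left =
      pullback.fst C'.hom (specExt k K) ≫ f.left := by
    have h1 : b.1.1.hom.left ≫ extendScalarsMapLeft K f = extendScalarsMapLeft K f :=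
      congrArg CommaMorphism.left b.1.2
    rw [Category.assoc, ← extendScalarsMapLeft_fst, reassoc_of% h1]
  obtain ⟨Q, g, h, hfac, hh, hgab, hinj, hex⟩ := AffineCoequalizer.exists_factorization f.left
    (fun b : B => b.1.1.hom.left ≫ pullback.fst C'.hom (specExt k K))
    (fun _ => pullback.fst C'.hom (specExt k K)) (pullback.fst C'.hom (specExt k K) ≫ f.left)
    hcomp (fun _ => rfl)
  have : IsFinite (g ≫ h) := by rwa [hfac]
  have : IsFinite h := isFinite_of_app_injective g h hinj
  have : IsFinite g := IsFinite.of_comp g h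
  have : IsSchemeTheoreticallyDominant g := isSchemeTheoreticallyDominant_of_app_injective g h hinj
  let CB : SchemeOver k := Over.mk (h ≫ C.hom)
  let g' : C' ⟶ CB := Over.homMk g (by
    change g ≫ h ≫ C.hom = _
    rw [reassoc_of% hfac, Over.w])
  let h' : CB ⟶ C := Over.homMk h rfl
  have : IsFinite g'.left := ‹IsFinite g›
  have : IsFinite h'.left := ‹IsFinite h›
  have : IsSchemeTheoreticallyDominant g'.left := ‹IsSchemeTheoreticallyDominant g›
  have : Finite (B.map (deckGroup K f).subtype) := Finite.Set.finite_image _ _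
  have hmodel : IsQuotientModel f B g' h' := by
    refine ⟨Over.OverMorphism.ext hfac, isGeometricQuotient_extendScalarsMap hσ g' ?_ ?_ ?_⟩
    · rintro _ ⟨b, hb, rfl⟩
      exact ⟨_, hB b hb, rfl⟩
    · rintro _ ⟨b, hb, rfl⟩
      ext : 1
      change b.1.hom.left ≫ extendScalarsMapLeft K g' = extendScalarsMapLeft K g'
      apply pullback.hom_ext
      · rw [Category.assoc, extendScalarsMapLeft_fst]
        exact (Category.assoc _ _ _).symm.trans (hgab ⟨b, hb⟩)
      · rw [Category.assoc, extendScalarsMapLeft_snd]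
        exact Over.w b.1.hom
    · intro y
      obtain ⟨U, hU, hy, -⟩ := exists_isAffineOpen_mem_and_subset (U := ⊤)
        (TopologicalSpace.Opens.mem_top (h y))
      refine ⟨h ⁻¹ᵁ U, hU.preimage h, hy, fun v hv => hex U hU v fun b h₁ h₂ => ?_⟩
      refine hv b.1.1 ⟨b.1, b.2, rfl⟩ _ ?_ h₁ h₂
      rw [← hfac]
      rfl
  exact ⟨CB, g', h', hf.isSmoothProjectiveCurve_of_isQuotientModel hmodel, hmodel⟩

end Existence

theorem proposition11 {k : Type u} [Field k] [Fintype k]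
    {K : Type u} [Field K] [Algebra k K] [IsAlgClosure k K]
    {C' C : SchemeOver k} (f : C' ⟶ C) (hf : IsUnramifiedAbelianCover K f) :
    -- the geometric automorphism group `A` is finite
    Finite (deckGroup K f) ∧
    -- (a) `B` is defined over `k`, and so is the curve `C_B = C'/B`
    IsDefinedOverBase f (frobeniusSubgroup K f hf.comm) ∧
    (∃ (CB : SchemeOver k) (g : C' ⟶ CB) (h : CB ⟶ C),
      IsSmoothProjectiveCurve CB ∧ IsQuotientModel f (frobeniusSubgroup K f hf.comm) g h) ∧
    -- (b) `C'(k)` and `C_B(k)` have the same image in `C(k)`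
    (∀ (CB : SchemeOver k) (g : C' ⟶ CB) (h : CB ⟶ C),
      IsQuotientModel f (frobeniusSubgroup K f hf.comm) g h →
      Set.range (fun P : RationalPoint C' => P ≫ f) =
        Set.range (fun Q : RationalPoint CB => Q ≫ h)) ∧
    -- (c) a point in the image of `C'(k)` has exactly `#A(k)` preimages in `C'(k)`
    (∀ R ∈ Set.range (fun P : RationalPoint C' => P ≫ f),
      {P : RationalPoint C' | P ≫ f = R}.ncard = (rationalDeck K f).ncard) ∧
    -- (d) a point in the image of `C_B(k)` has exactly `(A : B)` preimages in `C_B(k)`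
    (∀ (CB : SchemeOver k) (g : C' ⟶ CB) (h : CB ⟶ C),
      IsQuotientModel f (frobeniusSubgroup K f hf.comm) g h →
      ∀ R ∈ Set.range (fun Q : RationalPoint CB => Q ≫ h),
        {Q : RationalPoint CB | Q ≫ h = R}.ncard =
          (frobeniusSubgroup K f hf.comm).index) := by
  have : IsAlgClosed K := IsAlgClosure.isAlgClosed k
  have hB := isDefinedOverBase_frobeniusSubgroup f hf.comm
  refine ⟨hf.finite_deckGroup, hB, ?_, ?_, ?_, ?_⟩
  · refine hf.exists_isQuotientModel
      (fun _ hc => FiniteField.mem_range_algebraMap_of_frobenius_eq (k := k) hc) fun b hb => ?_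
    rw [← hB (FiniteField.frobeniusAlgEquivOfAlgebraic k K)⁻¹]
    exact ⟨b, hb, rfl⟩
  · intro CB g h hg
    apply Set.Subset.antisymm
    · rintro _ ⟨P, rfl⟩
      exact ⟨P ≫ g, by simp only [Category.assoc, hg.fac]⟩
    · rintro _ ⟨Q, rfl⟩
      exact hf.exists_comp_eq_of_isQuotientModel hg Q
  · rintro _ ⟨P, rfl⟩
    exact hf.ncard_fiber P
  · rintro CB g h hg _ ⟨Q, rfl⟩
    obtain ⟨P, hP⟩ := hf.exists_comp_eq_of_isQuotientModel hg Q
    rw [← hf.ncard_fiber_of_isQuotientModel hg P, hP]
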